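/- Let $R$ be a commutative ring, $G$ a (discrete) group, and $\mathcal F$ a family of finite subgroups of $G$ that is closed under conjugation and under taking subgroups. Let $\mathcal O_{\mathcal F}$ be the orbit category: its objects are the $G$-sets $G/H$ with $H\in\mathcal F$ and its morphisms are the $G$-maps. An $\mathcal O_{\mathcal F}$-module is a contravariant functor from $\mathcal O_{\mathcal F}$ to $R$-modules, and $\underline R$ is the constant $\mathcal O_{\mathcal F}$-module (every object is sent to $R$, every morphism to $\mathrm{id}_R$). Put $H^n_{\mathcal O_{\mathcal F}}(G,N)=\operatorname{Ext}^n_{\mathcal O_{\mathcal F}}(\underline R,N)$, the $\operatorname{Ext}$ group in the abelian category of $\mathcal O_{\mathcal F}$-modules. Let $\mathcal H_{\mathcal F}$ be the Hecke category: its objects are the $G/H$ with $H\in\mathcal F$, and the morphisms from $G/H$ to $G/K$ are the $RG$-module homomorphisms $R[G/H]\to R[G/K]$. An $\mathcal H_{\mathcal F}$-module is a contravariant $R$-linear functor from $\mathcal H_{\mathcal F}$ to $R$-modules. Let $R^-$ be the fixed point functor of the trivial $RG$-module $R$, that is, $R^-(G/H)=\operatorname{Hom}_{RG}(R[G/H],R)\cong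 R^H=R$, with morphisms of $\mathcal H_{\mathcal F}$ acting by precomposition. Put $H^n_{\mathcal H_{\mathcal F}}(G,M)=\operatorname{Ext}^n_{\mathcal H_{\mathcal F}}(R^-,M)$, the $\operatorname{Ext}$ group in the abelian category of $\mathcal H_{\mathcal F}$-modules. Let $\pi\circ\sigma:\mathcal O_{\mathcal F}\to\mathcal H_{\mathcal F}$ be the composite of the functor $\sigma$ from the orbit category to the Mackey category, $\sigma(G/H\xrightarrow{\alpha}G/K)=(G/H\xleftarrow{\mathrm{id}}G/H\xrightarrow{\alpha}G/K)$, and the functor $\pi$ from the Mackey category to $\mathcal H_{\mathcal F}$, which sends a basic morphism $G/H\xleftarrow{\alpha}G/L\xrightarrow{\beta}G/K$ to the map $R[G/H]\to R[G/K]$, $x\mapsto\sum_{\alpha(y)=x}\beta(y)$. Thus $\pi\circ\sigma$ is the identity on objects and sends a $G$-map to its $R$-linear extension. Let $\operatorname{Res}_{\pi\circ\sigma}M=M\circ(\pi\circ\sigma)$. Then for every $\mathcal H_{\mathcal F}$-module $M$ and every integer $n\ge 0$ there is an isomorphism of $R$-modules \[ H^n_{\mathcal H_{\mathcal F}}(G,M)\;\cong\;H^n_{\mathcal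 O_{\mathcal F}}(G,\operatorname{Res}_{\pi\circ\sigma}M). \] -/

import Mathlib

open CategoryTheory CategoryTheory.Limits Opposite

universe u

/-! ### Modules over an `R`-linear category -/

section LinearModules

variable (R : Type u) [CommRing R] (C : Type u) [Category.{u} C] [Preadditive C]
  [CategoryTheory.Linear R C]

/-- The contravariant functors from an `R`-linear category `C` to `R`-modules whose action on
each morphism module is `R`-linear. -/
def linearPresheaf : ObjectProperty (Cᵒᵖ ⥤ ModuleCat.{u} R) := fun M =>
  (∀ (X Y : C) (f g : X ⟶ Y), M.map (f + g).op = M.map f.op + M.map g.op) ∧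
  (∀ (X Y : C) (r : R) (f : X ⟶ Y), M.map (r • f).op = r • M.map f.op)

variable {R C}

/-- A contravariant functor with a pointwise jointly injective family of maps to `R`-linear
functors is `R`-linear. -/
lemma linearPresheaf_of_jointly_mono {ι : Type*} {M : Cᵒᵖ ⥤ ModuleCat.{u} R}
    {N : ι → (Cᵒᵖ ⥤ ModuleCat.{u} R)} (p : ∀ i, M ⟶ N i)
    (hp : ∀ (X : Cᵒᵖ) (Z : ModuleCat.{u} R) (a b : Z ⟶ M.obj X),
      (∀ i, a ≫ (p i).app X = b ≫ (p i).app X) → a = b)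
    (hN : ∀ i, linearPresheaf R C (N i)) : linearPresheaf R C M := by
  refine ⟨fun X Y f g => hp _ _ _ _ fun i => ?_, fun X Y r f => hp _ _ _ _ fun i => ?_⟩
  · rw [Preadditive.add_comp, (p i).naturality, (p i).naturality, (p i).naturality,
      (hN i).1, Preadditive.comp_add]
  · rw [CategoryTheory.Linear.smul_comp, (p i).naturality, (p i).naturality,
      (hN i).2, CategoryTheory.Linear.comp_smul]

instance : (linearPresheaf R C).IsClosedUnderSubobjects where
  prop_of_mono {_ N} i _ hN :=
    linearPresheaf_of_jointly_mono (ι := Unit) (N := fun _ => N) (fun _ => i)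
      (fun X _ _ _ h => (cancel_mono (i.app X)).1 (h ())) (fun _ => hN)

instance : (linearPresheaf R C).IsClosedUnderQuotients where
  prop_of_epi {M N} p _ hM := by
    refine ⟨fun X Y f g => ?_, fun X Y r f => ?_⟩
    · rw [← cancel_epi (p.app _), Preadditive.comp_add, ← p.naturality, ← p.naturality,
        ← p.naturality, hM.1, Preadditive.add_comp]
    · rw [← cancel_epi (p.app _), CategoryTheory.Linear.comp_smul, ← p.naturality,
        ← p.naturality, hM.2, CategoryTheory.Linear.smul_comp]

instance (J : Type) : (linearPresheaf R C).IsClosedUnderLimitsOfShape (Discrete J) where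
  limitsOfShape_le := by
    rintro M ⟨h⟩
    refine linearPresheaf_of_jointly_mono (fun j => h.π.app j) (fun X Z a b hab => ?_)
      h.prop_diag_obj
    exact (isLimitOfPreserves ((evaluation _ _).obj X) h.isLimit).hom_ext hab

instance : (linearPresheaf R C).IsClosedUnderFiniteProducts where

instance : (linearPresheaf R C).ContainsZero where
  exists_zero := by
    obtain ⟨Z, hZ⟩ := HasZeroObject.zero (C := Cᵒᵖ ⥤ ModuleCat.{u} R)
    refine ⟨Z, hZ, ?_⟩
    exact linearPresheaf_of_jointly_mono (ι := Empty) (N := fun _ => Z) (fun i => i.elim)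
      (fun X _ a b _ => (((evaluation _ _).obj X).map_isZero hZ).eq_of_tgt a b)
      (fun i => i.elim)

end LinearModules

/-! ### Families of finite subgroups and the Hecke category -/

/-- A family of finite subgroups of `G`, closed under conjugation and under subgroups. -/
structure FiniteSubgroupFamily (G : Type u) [Group G] where
  carrier : Set (Subgroup G)
  finite_mem : ∀ H ∈ carrier, Finite H
  conj_mem : ∀ H ∈ carrier, ∀ g : G, H.map (MulAut.conj g).toMonoidHom ∈ carrier
  subgroup_mem : ∀ H ∈ carrier, ∀ K : Subgroup G, K ≤ H → K ∈ carrier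

/-- The subgroups `H` in the family; `H` stands for the transitive `G`-set `G ⧸ H`. -/
abbrev FiniteSubgroupFamily.Mem {G : Type u} [Group G] (F : FiniteSubgroupFamily G) : Type u :=
  {H : Subgroup G // H ∈ F.carrier}

/-- The orbit category: objects are the `G`-sets `G ⧸ H` with `H ∈ F`, morphisms are `G`-maps. -/
structure OrbitCategory {G : Type u} [Group G] (F : FiniteSubgroupFamily G) where
  stab : F.Mem

namespace OrbitCategory

variable {G : Type u} [Group G] {F : FiniteSubgroupFamily G}

instance : Category.{u} (OrbitCategory F) where
  Hom X Y := (G ⧸ X.stab.1) →[G] (G ⧸ Y.stab.1)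
  id X := MulActionHom.id G
  comp f g := MulActionHom.comp g f

/-- A morphism of the orbit category, as a `G`-map. -/
def Hom.toGMap {X Y : OrbitCategory F} (f : X ⟶ Y) : (G ⧸ X.stab.1) →[G] (G ⧸ Y.stab.1) := f

end OrbitCategory

section Hecke

variable (R : Type u) [CommRing R] {G : Type u} [Group G] (F : FiniteSubgroupFamily G)

/-- The permutation module `R[G/H]`. -/
noncomputable abbrev permModule (H : F.Mem) : Rep.{u} R G := Rep.ofMulAction R G (G ⧸ H.1)

/-- The Hecke category: objects are the `G ⧸ H` with `H ∈ F`, morphisms from `G ⧸ H` to `G ⧸ K`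
are the `RG`-module homomorphisms `R[G/H] → R[G/K]`. -/
abbrev HeckeCategory : Type u := InducedCategory (Rep.{u} R G) (permModule R F)

/-- Modules over the Hecke category: contravariant `R`-linear functors to `R`-modules. -/
abbrev HeckeModule : Type (u + 1) := (linearPresheaf R (HeckeCategory R F)).FullSubcategory

/-- Modules over the orbit category: contravariant functors to `R`-modules. -/
abbrev OrbitModule : Type (u + 1) := (OrbitCategory F)ᵒᵖ ⥤ ModuleCat.{u} R

/-- The constant functor `R` on the orbit category: every object is sent to `R`, every
morphism to the identity. -/
abbrev constantOrbitModule : OrbitModule R F :=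
  (Functor.const (OrbitCategory F)ᵒᵖ).obj (ModuleCat.of R R)

/-- The fixed point functor `M^-` of an `RG`-module `M`, as a module over the Hecke category:
`G ⧸ H` is sent to `Hom_{RG}(R[G/H], M)`, which is `M^H` by evaluation at the coset `H`
(see `fixedPointModule_eval_bijective`), and morphisms act by precomposition. -/
noncomputable def fixedPointModule (M : Rep.{u} R G) : HeckeModule R F where
  obj := (inducedFunctor (permModule R F)).op ⋙ (linearYoneda R (Rep.{u} R G)).obj M
  property := by
    refine ⟨fun X Y f g => ?_, fun X Y r f => ?_⟩
    · ext φ : 2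
      exact Preadditive.add_comp (C := Rep.{u} R G) _ _ _ f.hom g.hom φ
    · ext φ : 2
      exact CategoryTheory.Linear.smul_comp (C := Rep.{u} R G) _ _ _ r f.hom φ

/-- `R^-`, the fixed point functor of the trivial `RG`-module `R`. -/
noncomputable abbrev trivialFixedPointModule : HeckeModule R F :=
  fixedPointModule R F (Rep.trivial R G R)

variable {F}

/-- Evaluation at the coset `H` identifies the value of `M^-` at `G ⧸ H` with the `H`-fixed
points of `M`. -/
lemma fixedPointModule_eval_bijective (M : Rep.{u} R G) (H : F.Mem) :
    Function.Injective (fun φ : permModule R F H ⟶ M =>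
      φ.hom (MonoidAlgebra.single (QuotientGroup.mk (1 : G)) (1 : R))) ∧
    Set.range (fun φ : permModule R F H ⟶ M =>
      φ.hom (MonoidAlgebra.single (QuotientGroup.mk (1 : G)) (1 : R))) =
      {m : M | ∀ h ∈ H.1, M.ρ h m = m} := by
  have key : ∀ (φ : permModule R F H ⟶ M) (g : G),
      φ.hom (MonoidAlgebra.single (QuotientGroup.mk g) (1 : R)) =
        M.ρ g (φ.hom (MonoidAlgebra.single (QuotientGroup.mk (1 : G)) (1 : R))) := by
    intro φ g
    have h := Rep.hom_comm_apply φ g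
      (MonoidAlgebra.single (QuotientGroup.mk (1 : G)) (1 : R))
    rw [← h]
    congr 1
    refine ((Representation.ofMulAction_single g _ _).trans ?_).symm
    simp
  constructor
  · intro φ ψ h
    refine Rep.hom_ext ?_
    refine Representation.IntertwiningMap.toLinearMap_injective _ _ ?_
    refine MonoidAlgebra.lhom_ext' fun x => LinearMap.ext_ring ?_
    obtain ⟨g, rfl⟩ := QuotientGroup.mk_surjective x
    exact (key φ g).trans ((congrArg (M.ρ g) h).trans (key ψ g).symm)
  · ext m
    constructor
    · rintro ⟨φ, rfl⟩ h hh
      refine (key φ h).symm.trans ?_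
      congr 2
      exact (QuotientGroup.eq.2 (by simpa using hh)).symm
    · intro hm
      let c : G ⧸ H.1 → M := Quotient.lift (fun g => M.ρ g m) (by
        intro a b hab
        have hab' : a⁻¹ * b ∈ H.1 := QuotientGroup.leftRel_apply.1 hab
        have := hm _ hab'
        change M.ρ a m = M.ρ b m
        conv_lhs => rw [← this]
        rw [← Module.End.mul_apply, ← map_mul, mul_inv_cancel_left])
      let l : MonoidAlgebra R (G ⧸ H.1) →ₗ[R] M :=
        Finsupp.linearCombination R c ∘ₗ (MonoidAlgebra.coeffLinearEquiv R).toLinearMap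
      have hl : ∀ x, l (MonoidAlgebra.single x 1) = c x := by
        intro x
        simp [l]
      refine ⟨Rep.ofHom ⟨l, fun g => ?_⟩, ?_⟩
      · refine MonoidAlgebra.lhom_ext' fun x => LinearMap.ext_ring ?_
        obtain ⟨a, rfl⟩ := QuotientGroup.mk_surjective x
        simp only [LinearMap.comp_apply, MonoidAlgebra.lsingle_apply,
          Representation.ofMulAction_single, hl]
        change M.ρ (g * a) m = M.ρ g (M.ρ a m)
        rw [map_mul, Module.End.mul_apply]
      · refine (hl _).trans ?_
        change M.ρ 1 m = m
        simp

end Hecke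

/-! ### Restriction from the Hecke category to the orbit category -/

section Restriction

variable (R : Type u) [CommRing R] {G : Type u} [Group G] {F : FiniteSubgroupFamily G}

/-- A diagram `G/H ← G/L → G/K` of `G`-maps with `L ∈ F`: these represent the basic morphisms
from `G/H` to `G/K` in the Mackey category. -/
structure MackeySpan (H K : F.Mem) where
  apex : F.Mem
  left : (G ⧸ apex.1) →[G] (G ⧸ H.1)
  right : (G ⧸ apex.1) →[G] (G ⧸ K.1)

namespace MackeySpan

/-- The functor `σ` from the orbit category to the Mackey category, on `G`-maps:
`α : G/H → G/K` is sent to `G/H ← G/H → G/K` with legs `id` and `α`. -/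
def sigma {H K : F.Mem} (α : (G ⧸ H.1) →[G] (G ⧸ K.1)) : MackeySpan H K :=
  ⟨H, MulActionHom.id G, α⟩

variable {H K : F.Mem} (m : MackeySpan H K)

lemma finite_fibre (x : G ⧸ H.1) : (m.left ⁻¹' {x}).Finite := by
  have : Finite H.1 := F.finite_mem _ H.2
  obtain ⟨g, rfl⟩ := QuotientGroup.mk_surjective x
  by_cases hne : ∃ y, m.left y = QuotientGroup.mk g
  · obtain ⟨y, hy⟩ := hne
    refine (Set.finite_range (fun h : H.1 => (g * (h : G) * g⁻¹) • y)).subset ?_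
    intro z hz
    obtain ⟨a, rfl⟩ := MulAction.exists_smul_eq G y z
    have ha : m.left (a • y) = QuotientGroup.mk g := hz
    rw [map_smul, hy, MulAction.Quotient.smul_mk, eq_comm, QuotientGroup.eq] at ha
    refine ⟨⟨_, ha⟩, ?_⟩
    simp [mul_assoc]
  · convert Set.finite_empty
    ext z
    simp only [Set.mem_preimage, Set.mem_singleton_iff, Set.mem_empty_iff_false, iff_false]
    exact fun hz => hne ⟨z, hz⟩

/-- The functor `π` from the Mackey category to the Hecke category, on basic morphisms:
`G/H ← G/L → G/K` with legs `α`, `β` is sent to the map `R[G/H] → R[G/K]` with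
`x ↦ ∑ β y` over the (finitely many) `y` with `α y = x`. -/
noncomputable def piLinear : MonoidAlgebra R (G ⧸ H.1) →ₗ[R] MonoidAlgebra R (G ⧸ K.1) :=
  Finsupp.linearCombination R
    (fun x => ∑ y ∈ (m.finite_fibre x).toFinset, MonoidAlgebra.single (m.right y) (1 : R)) ∘ₗ
  (MonoidAlgebra.coeffLinearEquiv R).toLinearMap

lemma piLinear_single (x : G ⧸ H.1) (r : R) :
    m.piLinear R (MonoidAlgebra.single x r) =
      ∑ y ∈ (m.finite_fibre x).toFinset, MonoidAlgebra.single (m.right y) r := by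
  simp [piLinear, Finset.smul_sum]

/-- `π` of a basic morphism is `RG`-linear. -/
noncomputable def pi : permModule R F H ⟶ permModule R F K :=
  Rep.ofHom ⟨m.piLinear R, fun g => by
    refine MonoidAlgebra.lhom_ext' fun x => LinearMap.ext_ring ?_
    simp only [LinearMap.comp_apply, MonoidAlgebra.lsingle_apply,
      Representation.ofMulAction_single, piLinear_single, map_sum]
    refine (Finset.sum_bij (fun y _ => g • y) ?_ ?_ ?_ ?_).symm
    · intro y hy
      have hy' : m.left y = x := (m.finite_fibre x).mem_toFinset.1 hy
      refine (m.finite_fibre (g • x)).mem_toFinset.2 ?_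
      change m.left (g • y) = g • x
      rw [map_smul, hy']
    · intro y _ z _ h
      exact smul_left_cancel g h
    · intro z hz
      have hz' : m.left z = g • x := (m.finite_fibre (g • x)).mem_toFinset.1 hz
      refine ⟨g⁻¹ • z, (m.finite_fibre x).mem_toFinset.2 ?_, smul_inv_smul g z⟩
      change m.left (g⁻¹ • z) = x
      rw [map_smul, hz', inv_smul_smul]
    · intro y _
      rw [map_smul]⟩

lemma pi_hom_single (x : G ⧸ H.1) (r : R) :
    (m.pi R).hom (MonoidAlgebra.single x r) =
      ∑ y ∈ (m.finite_fibre x).toFinset, MonoidAlgebra.single (m.right y) r :=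
  m.piLinear_single R x r

/-- `π (σ α)` is the linearization of `α`. -/
lemma pi_sigma_single (α : (G ⧸ H.1) →[G] (G ⧸ K.1)) (x : G ⧸ H.1) (r : R) :
    ((sigma α).pi R).hom (MonoidAlgebra.single x r) = MonoidAlgebra.single (α x) r := by
  rw [pi_hom_single]
  refine Finset.sum_eq_single (M := MonoidAlgebra R (G ⧸ K.1)) (x : G ⧸ H.1) ?_ ?_
  · intro y hy hne
    exact absurd (((sigma α).finite_fibre x).mem_toFinset.1 hy) hne
  · intro hx
    exact absurd (((sigma α).finite_fibre x).mem_toFinset.2 rfl) hx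

end MackeySpan

variable (F)

/-- The composite functor `π ∘ σ` from the orbit category to the Hecke category. -/
noncomputable def orbitToHecke : OrbitCategory F ⥤ HeckeCategory R F where
  obj X := X.stab
  map {X Y} α := InducedCategory.homMk ((MackeySpan.sigma (OrbitCategory.Hom.toGMap α)).pi R)
  map_id X := by
    refine InducedCategory.hom_ext (Rep.hom_ext ?_)
    refine Representation.IntertwiningMap.toLinearMap_injective _ _ ?_
    refine MonoidAlgebra.lhom_ext' fun x => LinearMap.ext_ring ?_
    exact MackeySpan.pi_sigma_single R _ x 1
  map_comp {X Y Z} f g := by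
    refine InducedCategory.hom_ext (Rep.hom_ext ?_)
    refine Representation.IntertwiningMap.toLinearMap_injective _ _ ?_
    refine MonoidAlgebra.lhom_ext' fun x => LinearMap.ext_ring ?_
    refine (MackeySpan.pi_sigma_single R _ x 1).trans ?_
    refine (MackeySpan.pi_sigma_single R (OrbitCategory.Hom.toGMap g)
      (OrbitCategory.Hom.toGMap f x) 1).symm.trans ?_
    exact congrArg _ (MackeySpan.pi_sigma_single R (OrbitCategory.Hom.toGMap f) x 1).symm

/-- Restriction of modules along `π ∘ σ`. -/
noncomputable def resOrbit (M : HeckeModule R F) : OrbitModule R F :=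
  (orbitToHecke R F).op ⋙ M.obj

/-- Cohomology over the orbit category (Bredon cohomology): `Ext` from the constant functor. -/
noncomputable def orbitCohomology (N : OrbitModule R F) (n : ℕ) : Type (u + 1) :=
  letI := HasExt.standard (OrbitModule R F)
  Abelian.Ext (constantOrbitModule R F) N n

/-- Cohomology over the Hecke category: `Ext` from the fixed point functor `R^-`. -/
noncomputable def heckeCohomology (M : HeckeModule R F) (n : ℕ) : Type (u + 1) :=
  letI := HasExt.standard (HeckeModule R F)
  Abelian.Ext (trivialFixedPointModule R F) M n

noncomputable instance (N : OrbitModule R F) (n : ℕ) : AddCommGroup (orbitCohomology R F N n) :=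
  letI := HasExt.standard (OrbitModule R F)
  inferInstanceAs (AddCommGroup (Abelian.Ext (constantOrbitModule R F) N n))

noncomputable instance (M : HeckeModule R F) (n : ℕ) : AddCommGroup (heckeCohomology R F M n) :=
  letI := HasExt.standard (HeckeModule R F)
  inferInstanceAs (AddCommGroup (Abelian.Ext (trivialFixedPointModule R F) M n))

noncomputable instance (N : OrbitModule R F) (n : ℕ) : Module R (orbitCohomology R F N n) :=
  letI := HasExt.standard (OrbitModule R F)
  inferInstanceAs (Module R (Abelian.Ext (constantOrbitModule R F) N n))

noncomputable instance (M : HeckeModule R F) (n : ℕ) : Module R (heckeCohomology R F M n) :=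
  letI := HasExt.standard (HeckeModule R F)
  inferInstanceAs (Module R (Abelian.Ext (trivialFixedPointModule R F) M n))

end Restriction

/-! The two trivial coefficient modules have projective resolutions built from the same simplicial
`G`-set, and the two complexes of homomorphisms out of them agree term by term.

A `G`-set `X` yields an orbit module `orbitPerm X : G/K ↦ R[Hom_G(G/K, X)]` and a Hecke module
`heckePerm X : G/K ↦ Hom_RG(R[G/K], R[X])`. At the one-point set these are the constant module and
`R^-`. If `X` is a disjoint union of orbits `G/H_i` with `H_i ∈ F`, a Yoneda argument identifies
`Hom(orbitPerm X, N)` with `∏ N(G/H_i)` and `Hom(heckePerm X, M)` with `∏ M(G/H_i)`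
(`orbitPerm_eval_bijective`, `heckePerm_eval_bijective`). The Hecke case works for infinitely many
orbits because `R[G/K]` is generated by one element (`finite_comp_proj`). Hence both modules are
projective, and `Hom(heckePerm X, M) ≅ Hom(orbitPerm X, Res M)` naturally in `X`
(`restrictHom_bijective`, `restrictHom_naturality`).

Let `D` be the disjoint union of all `G/H` with `H ∈ F`. Stabilizers of points of `D^(n+1)` lie in
`F`, so the Čech nerve of `D` gives complexes of projectives. Exactness may be tested at each `G/K`
separately. There the inclusion `δ : G/K → D` provides a vertex to put in front of every simplex: a
`G`-map `f` becomes `(δ, f)`, and an `RG`-map `φ` becomes the map with `y ↦ δ(y) ⊗ φ(y)` on cosets.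
This contraction depends on `K`, but it is natural in `X`, which is all that an extra degeneracy
requires. -/

/-! ### `Ext` groups via projective resolutions, linearly -/

section ExtLinear

open CategoryTheory.Abelian

namespace CategoryTheory.ProjectiveResolution

universe w v u' t

variable {R : Type t} [CommRing R] {C : Type u'} [Category.{v} C] [Abelian C]
  [CategoryTheory.Linear R C] {X : C} (P : ProjectiveResolution X) (Y : C)

section Cocycles

variable (R)

/-- The cocycles of degree `n` of the complex `Hom(P, Y)`. -/
def homCocycles (n : ℕ) : Submodule R (P.complex.X n ⟶ Y) :=
  LinearMap.ker (Linear.leftComp R Y (P.complex.d (n + 1) n))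

variable {Y R} in
lemma mem_homCocycles {n : ℕ} {f : P.complex.X n ⟶ Y} :
    f ∈ P.homCocycles R Y n ↔ P.complex.d (n + 1) n ≫ f = 0 := Iff.rfl

end Cocycles

variable [HasExt.{w} C]

variable {Y} in
-- A scalar acts on `Ext` by composition with the degree-zero class of `r • 𝟙`, which can be
-- absorbed into the representing cocycle. This makes the final isomorphism `R`-linear rather than
-- only additive.
lemma smul_extMk {n : ℕ} (r : R) (f : P.complex.X n ⟶ Y) (m : ℕ) (hm : n + 1 = m)
    (hf : P.complex.d m n ≫ f = 0) :
    r • P.extMk f m hm hf = P.extMk (r • f) m hm (by simp [hf]) := by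
  rw [Ext.smul_eq_comp_mk₀, extMk_comp_mk₀]
  congr 1
  simp

variable {Y} in
-- The index `p` is left free so that degree `0` needs no separate statement: `d n p` vanishes
-- unless `p + 1 = n`, so in degree `0` the only coboundary is `0`.
lemma extMk_eq_zero_iff_exists {n : ℕ} (f : P.complex.X n ⟶ Y) (m : ℕ) (hm : n + 1 = m)
    (hf : P.complex.d m n ≫ f = 0) :
    P.extMk f m hm hf = 0 ↔
      ∃ (p : ℕ) (g : P.complex.X p ⟶ Y), P.complex.d n p ≫ g = f := by
  rcases n with _ | n
  · have : P.extMk f m hm hf = 0 ↔ f = 0 := by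
      simp only [← P.extEquivCohomologyClass.apply_eq_iff_eq,
        extEquivCohomologyClass_extMk, extEquivCohomologyClass_zero,
        CochainComplex.HomComplex.CohomologyClass.mk_eq_zero_iff]
      rw [CochainComplex.HomComplex.Cocycle.toSingleMk_mem_coboundaries_iff _ _ _ _ _ 1 (by simp)]
      -- Cochain degree `1` is chain degree `-1`, where the resolution vanishes.
      have hz : IsZero (P.cochainComplex.X 1) :=
        P.cochainComplex.isZero_of_isStrictlyLE 0 1 (by simp)
      constructor
      · rintro ⟨g, hg⟩
        rw [hz.eq_of_src g 0, comp_zero] at hg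
        exact (cancel_epi (P.cochainComplexXIso (-(0 : ℕ)) 0 rfl).hom).1 (by simpa using! hg.symm)
      · rintro rfl
        exact ⟨0, by simp⟩
    rw [this]
    exact ⟨fun h => ⟨0, 0, by simp [h]⟩, by rintro ⟨p, g, rfl⟩; simp⟩
  · rw [P.extMk_eq_zero_iff f m hm hf n rfl]
    refine ⟨fun ⟨g, hg⟩ => ⟨n, g, hg⟩, fun ⟨p, g, hg⟩ => ?_⟩
    by_cases hp : p = n
    · subst hp
      exact ⟨g, hg⟩
    -- Here `d (n + 1) p = 0`, so `f = 0` and the zero map is a witness.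
    · exact ⟨0, by rw [← hg, P.complex.shape (n + 1) p (fun h => hp (Nat.succ.inj h))]; simp⟩

variable (R)

/-- The `R`-linear map from the cocycles of `Hom(P, Y)` to `Ext`. -/
noncomputable def extMkLinear (n : ℕ) : P.homCocycles R Y n →ₗ[R] Ext X Y n where
  toFun f := P.extMk f.1 (n + 1) rfl f.2
  map_add' f g := (P.add_extMk f.1 g.1 _ rfl f.2 g.2).symm
  map_smul' r f := (P.smul_extMk r f.1 _ rfl f.2).symm

lemma extMkLinear_surjective (n : ℕ) : Function.Surjective (P.extMkLinear R Y n) := fun x => by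
  obtain ⟨f, hf, rfl⟩ := P.extMk_surjective x (n + 1) rfl
  exact ⟨⟨f, hf⟩, rfl⟩

variable {R Y}
variable {D : Type*} [Category* D] [Abelian D] [CategoryTheory.Linear R D] [HasExt.{w} D]
  {X' : D} (Q : ProjectiveResolution X') {Y' : D}

/-- An isomorphism between the complexes `Hom(P, Y)` and `Hom(Q, Y')` induces an isomorphism
between the `Ext` groups which they compute. -/
theorem nonempty_ext_linearEquiv
    (e : ∀ n, (P.complex.X n ⟶ Y) ≃ₗ[R] (Q.complex.X n ⟶ Y'))
    (he : ∀ (i j : ℕ) (f : P.complex.X j ⟶ Y),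
      e i (P.complex.d i j ≫ f) = Q.complex.d i j ≫ e j f) (n : ℕ) :
    Nonempty (Ext X Y n ≃ₗ[R] Ext X' Y' n) := by
  have hmap : (P.homCocycles R Y n).map (e n).toLinearMap = Q.homCocycles R Y' n := by
    ext f
    rw [Submodule.mem_map_equiv, mem_homCocycles, mem_homCocycles, ← (e (n + 1)).map_eq_zero_iff,
      he, LinearEquiv.apply_symm_apply]
  let c : P.homCocycles R Y n ≃ₗ[R] Q.homCocycles R Y' n := (e n).ofSubmodules _ _ hmap
  -- These kernels are the coboundaries. A witness `g` in degree `p` is transported by `e p`,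
  -- uniformly in `n`.
  have hker : (LinearMap.ker (P.extMkLinear R Y n)).map c.toLinearMap =
      LinearMap.ker (Q.extMkLinear R Y' n) := by
    ext f
    obtain ⟨f, rfl⟩ := c.surjective f
    rw [Submodule.mem_map_equiv, LinearEquiv.symm_apply_apply, LinearMap.mem_ker,
      LinearMap.mem_ker]
    refine (P.extMk_eq_zero_iff_exists f.1 _ rfl f.2).trans
      (Iff.trans ?_ (Q.extMk_eq_zero_iff_exists (c f).1 _ rfl (c f).2).symm)
    constructor
    · rintro ⟨p, g, hg⟩
      exact ⟨p, e p g, by rw [← he, hg]; rfl⟩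
    · rintro ⟨p, g, hg⟩
      refine ⟨p, (e p).symm g, (e n).injective ?_⟩
      rw [he, LinearEquiv.apply_symm_apply, hg]
      rfl
  exact ⟨((P.extMkLinear R Y n).quotKerEquivOfSurjective (P.extMkLinear_surjective R Y n)).symm ≪≫ₗ
    Submodule.Quotient.equiv _ _ c hker ≪≫ₗ
    (Q.extMkLinear R Y' n).quotKerEquivOfSurjective (Q.extMkLinear_surjective R Y' n)⟩

end CategoryTheory.ProjectiveResolution

end ExtLinear

/-! ### Resolutions from augmented simplicial objects -/

section Simplicial

open AlgebraicTopology

universe v₁ v₂ u₁ u₂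

variable {A : Type u₁} [Category.{v₁} A] [Abelian A] {B : Type u₂} [Category.{v₂} B] [Abelian B]

/-- A functor preserving homology satisfies `F(H(S)) ≅ H(F(S))` naturally in `S`, so the claim
follows from the naturality square of this isomorphism. -/
lemma CategoryTheory.ShortComplex.isIso_map_homologyMap {S₁ S₂ : ShortComplex A} (φ : S₁ ⟶ S₂)
    (F : A ⥤ B) [F.Additive] [F.PreservesHomology]
    (h : ShortComplex.QuasiIso (F.mapShortComplex.map φ)) :
    IsIso (F.map (ShortComplex.homologyMap φ)) := by
  have h1 : IsIso (@ShortComplex.homologyMap _ _ _ (S₁.map F) (S₂.map F)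
      (F.mapShortComplex.map φ) _ _) := h.isIso'
  have h2 := ShortComplex.mapHomologyIso_hom_naturality (F := F) φ
  have h3 : IsIso ((S₁.mapHomologyIso F).hom ≫ F.map (ShortComplex.homologyMap φ)) := by
    rw [← h2]
    infer_instance
  exact (isIso_comp_left_iff _ _).1 h3

/-- Quasi-isomorphisms are detected by a family of exact functors which jointly reflect
isomorphisms. -/
lemma quasiIso_of_jointly_reflects {ι κ : Type*} {c : ComplexShape κ} (ev : ι → A ⥤ B)
    [∀ i, (ev i).Additive] [∀ i, (ev i).PreservesHomology]
    (hev : ∀ ⦃X Y : A⦄ (f : X ⟶ Y), (∀ i, IsIso ((ev i).map f)) → IsIso f)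
    {K L : HomologicalComplex A c} (φ : K ⟶ L)
    (h : ∀ i, QuasiIso (((ev i).mapHomologicalComplex c).map φ)) : QuasiIso φ := by
  refine ⟨fun j => ?_⟩
  rw [quasiIsoAt_iff_isIso_homologyMap]
  exact hev _ fun i => ShortComplex.isIso_map_homologyMap
    ((HomologicalComplex.shortComplexFunctor A c j).map φ) (ev i)
    ((quasiIsoAt_iff _ _).1 ((h i).quasiIsoAt j))

/-- If the image of an augmented simplicial object under an additive functor has an extra
degeneracy, then this functor sends the augmentation of the alternating face map complex to a
quasi-isomorphism. -/
lemma quasiIso_map_ε (F : A ⥤ B) [F.Additive] (X : SimplicialObject.Augmented A)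
    (ed : (((SimplicialObject.Augmented.whiskering A B).obj F).obj X).ExtraDegeneracy) :
    QuasiIso ((F.mapHomologicalComplex _).map (AlternatingFaceMapComplex.ε.app X)) := by
  let X' := ((SimplicialObject.Augmented.whiskering A B).obj F).obj X
  let K := AlternatingFaceMapComplex.obj X.left
  let K' := AlternatingFaceMapComplex.obj (SimplicialObject.Augmented.drop.obj X')
  -- Additivity lets `F` pass through the alternating sums of faces, so the identities in each
  -- degree commute with the differentials.
  let φ : (F.mapHomologicalComplex _).obj K ≅ K' :=
    HomologicalComplex.Hom.isoOfComponents (fun _ => Iso.refl _) (by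
      rintro i j (rfl : j + 1 = i)
      refine (Category.id_comp _).trans (Eq.trans ?_ (Category.comp_id _).symm)
      rw [Functor.mapHomologicalComplex_obj_d, AlternatingFaceMapComplex.obj_d_eq,
        AlternatingFaceMapComplex.obj_d_eq]
      simp only [Functor.map_sum, Functor.map_zsmul]
      rfl)
  let ψ : (F.mapHomologicalComplex _).obj ((ChainComplex.single₀ A).obj X.right) ≅
      (ChainComplex.single₀ B).obj (F.obj X.right) :=
    (HomologicalComplex.singleMapHomologicalComplex F (ComplexShape.down ℕ) 0).app X.right
  let ε' : K' ⟶ (ChainComplex.single₀ B).obj (F.obj X.right) := ed.homotopyEquiv.hom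
  have hq : QuasiIso ε' := inferInstanceAs (QuasiIso ed.homotopyEquiv.hom)
  have h : (F.mapHomologicalComplex _).map (AlternatingFaceMapComplex.ε.app X) =
      φ.hom ≫ ε' ≫ ψ.inv := by
    rw [← Category.assoc, Iso.eq_comp_inv]
    -- The target is concentrated in degree `0`, so only the components there have to be compared.
    refine HomologicalComplex.to_single_hom_ext ?_
    have h1 : ψ.hom.f 0 = 𝟙 _ := by
      simp [ψ]
      rfl
    have h2 : ε'.f 0 = F.map (X.hom.app (op (SimplexCategory.mk 0))) :=
      (AlternatingFaceMapComplex.ε_app_f_zero X').trans (Category.comp_id _)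
    have h3 : φ.hom.f 0 = 𝟙 _ := rfl
    change F.map ((AlternatingFaceMapComplex.ε.app X).f 0) ≫ ψ.hom.f 0 = φ.hom.f 0 ≫ ε'.f 0
    rw [h1, h2, h3, AlternatingFaceMapComplex.ε_app_f_zero]
    exact (Category.comp_id _).trans (Category.id_comp _).symm
  rw [h]
  infer_instance

/-- An augmented simplicial object consisting of projective objects gives a projective
resolution, if it acquires extra degeneracies after applying each of a jointly conservative
family of exact functors. -/
noncomputable def projectiveResolutionOfExtraDegeneracy {ι : Type*} (ev : ι → A ⥤ B)
    [∀ i, (ev i).Additive] [∀ i, (ev i).PreservesHomology]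
    (hev : ∀ ⦃X Y : A⦄ (f : X ⟶ Y), (∀ i, IsIso ((ev i).map f)) → IsIso f)
    (X : SimplicialObject.Augmented A) (hX : ∀ n, Projective (X.left.obj n))
    (ed : ∀ i, (((SimplicialObject.Augmented.whiskering A B).obj (ev i)).obj X).ExtraDegeneracy) :
    ProjectiveResolution X.right where
  complex := AlternatingFaceMapComplex.obj X.left
  projective _ := hX _
  π := AlternatingFaceMapComplex.ε.app X
  quasiIso := quasiIso_of_jointly_reflects ev hev _ fun i => quasiIso_map_ε (ev i) X (ed i)

end Simplicial

/-! ### `G`-sets and their Čech nerves -/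

section GSets

variable (G : Type u) [Group G]

/-- The category of `G`-sets: objects are types with a `G`-action, morphisms are `G`-maps. -/
structure GSetCat where
  carrier : Type u
  [action : MulAction G carrier]

namespace GSetCat

attribute [instance] action

variable {G}

instance : Category.{u} (GSetCat G) where
  Hom X Y := X.carrier →[G] Y.carrier
  id X := MulActionHom.id G
  comp f g := MulActionHom.comp g f

/-- A morphism of `G`-sets as a `G`-map. -/
def Hom.toGMap {X Y : GSetCat G} (f : X ⟶ Y) : X.carrier →[G] Y.carrier := f

/-- A `G`-map as a morphism of `G`-sets. -/
def homMk {X Y : GSetCat G} (f : X.carrier →[G] Y.carrier) : X ⟶ Y := f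

@[ext]
lemma hom_ext {X Y : GSetCat G} {f g : X ⟶ Y}
    (h : ∀ x, Hom.toGMap f x = Hom.toGMap g x) : f = g :=
  MulActionHom.ext h

/-- The one-point `G`-set. -/
def point : GSetCat G where
  carrier := PUnit
  action := { smul := fun _ x => x, one_smul := fun _ => rfl, mul_smul := fun _ _ _ => rfl }

/-- The map to the one-point `G`-set. -/
def toPoint (X : GSetCat G) : X ⟶ point :=
  homMk ⟨fun _ => PUnit.unit, fun _ _ => rfl⟩

variable (D : GSetCat G)

/-- The product of two `G`-sets with the diagonal action. -/
def prod (X : GSetCat G) : GSetCat G where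
  carrier := D.carrier × X.carrier

/-- The second projection. -/
def prodSnd (X : GSetCat G) : D.prod X ⟶ X :=
  homMk ⟨Prod.snd, fun _ _ => rfl⟩

/-- The map `D × X → D × Y` induced by `X → Y`. -/
def prodMap {X Y : GSetCat G} (f : X ⟶ Y) : D.prod X ⟶ D.prod Y :=
  homMk ⟨fun p => (p.1, Hom.toGMap f p.2), fun g p => Prod.ext rfl (map_smul (Hom.toGMap f) g p.2)⟩

/-- The simplicial `G`-set whose `n`-simplices are the `(n + 1)`-tuples of elements of `D`. -/
def cech : SimplicialObject (GSetCat G) where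
  obj n := { carrier := Fin (n.unop.len + 1) → D.carrier }
  map f := homMk ⟨fun x i => x (f.unop.toOrderHom i), fun _ _ => rfl⟩

/-- Adding a vertex in front of a simplex. -/
def cechCons (n : ℕ) :
    D.prod (D.cech.obj (op (SimplexCategory.mk n))) ⟶
      D.cech.obj (op (SimplexCategory.mk (n + 1))) :=
  homMk ⟨fun p => (Fin.cons p.1 p.2 : Fin (n + 2) → D.carrier), fun g p => by
    funext i
    refine Fin.cases ?_ (fun j => ?_) i <;> rfl⟩

/-- A vertex as a `0`-simplex. -/
def cechVertex : D.prod point ⟶ D.cech.obj (op (SimplexCategory.mk 0)) :=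
  homMk ⟨fun p _ => p.1, fun _ _ => rfl⟩

/-- This and the next four lemmas are the extra degeneracy identities with the new vertex kept as a
variable in `D`. In general no vertex is fixed by `G`, so an actual degeneracy appears only after
evaluation at some `G/K`. -/
lemma cechVertex_comp_toPoint : D.cechVertex ≫ toPoint _ = D.prodSnd point := rfl

lemma cechCons_comp_δ_zero (n : ℕ) : D.cechCons n ≫ D.cech.δ 0 = D.prodSnd _ := rfl

lemma cechCons_zero_comp_δ_one : D.cechCons 0 ≫ D.cech.δ 1 =
    D.prodMap (toPoint _) ≫ D.cechVertex := by
  ext p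
  funext i
  obtain rfl : i = (0 : Fin 1) := Subsingleton.elim (α := Fin 1) _ _
  rfl

lemma cechCons_comp_δ_succ (n : ℕ) (i : Fin (n + 2)) :
    D.cechCons (n + 1) ≫ D.cech.δ i.succ = D.prodMap (D.cech.δ i) ≫ D.cechCons n := by
  ext p
  funext j
  change (Fin.cons p.1 p.2 : Fin (n + 3) → D.carrier) (i.succ.succAbove j) =
    (Fin.cons p.1 (fun k => p.2 (i.succAbove k)) : Fin (n + 2) → D.carrier) j
  refine Fin.cases ?_ (fun k => ?_) j
  · simp
    rfl
  · simp
    rfl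

lemma cechCons_comp_σ_succ (n : ℕ) (i : Fin (n + 1)) :
    D.cechCons n ≫ D.cech.σ i.succ = D.prodMap (D.cech.σ i) ≫ D.cechCons (n + 1) := by
  ext p
  funext j
  change (Fin.cons p.1 p.2 : Fin (n + 2) → D.carrier) (i.succ.predAbove j) =
    (Fin.cons p.1 (fun k => p.2 (i.predAbove k)) : Fin (n + 3) → D.carrier) j
  refine Fin.cases ?_ (fun k => ?_) j
  · simp
    rfl
  · simp
    rfl

section Augmented

variable {A B : Type*} [Category* A] [Category* B] (P : GSetCat G ⥤ A) {Z : A}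
  (θ : P.obj point ≅ Z)

/-- The image of the Čech nerve of `D` under a functor `P`, augmented towards the image of the
one-point `G`-set. -/
def augmentedCech : SimplicialObject.Augmented A where
  left := D.cech ⋙ P
  right := Z
  hom :=
    { app := fun _ => P.map (toPoint _) ≫ θ.hom
      naturality := fun X Y f => by
        refine Eq.trans ?_ (Category.comp_id _).symm
        refine (Category.assoc _ _ _).symm.trans (congrArg (· ≫ θ.hom) ?_)
        exact (P.map_comp (D.cech.map f) (toPoint _)).symm }

/-- The image of `D.augmentedCech P θ` under a functor `ev` has an extra degeneracy if, for
`E = P ⋙ ev`, the projections `E(D × X) → E(X)` have a section which is natural in `X`. -/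
def extraDegeneracyOfSection (ev : A ⥤ B)
    (τ : ∀ X, ev.obj (P.obj X) ⟶ ev.obj (P.obj (D.prod X)))
    (hτ : ∀ {X Y : GSetCat G} (f : X ⟶ Y),
      τ X ≫ ev.map (P.map (D.prodMap f)) = ev.map (P.map f) ≫ τ Y)
    (hτ' : ∀ X, τ X ≫ ev.map (P.map (D.prodSnd X)) = 𝟙 _) :
    (((SimplicialObject.Augmented.whiskering _ _).obj ev).obj
      (D.augmentedCech P θ)).ExtraDegeneracy where
  -- The section `τ` supplies the vertex, which is then put in front. Naturality of `τ` moves it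
  -- past faces and degeneracies, reducing each identity to one for `cechCons` or `cechVertex`.
  s' := ev.map θ.inv ≫ τ point ≫ ev.map (P.map D.cechVertex)
  s n := τ _ ≫ ev.map (P.map (D.cechCons n))
  s'_comp_ε := by
    change (ev.map θ.inv ≫ τ point ≫ ev.map (P.map D.cechVertex)) ≫
      ev.map (P.map (toPoint _) ≫ θ.hom) ≫ 𝟙 _ = 𝟙 _
    have h : τ point ≫ ev.map (P.map D.cechVertex) ≫ ev.map (P.map (toPoint _)) = 𝟙 _ := by
      rw [← ev.map_comp, ← P.map_comp, cechVertex_comp_toPoint, hτ']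
    rw [Category.comp_id, ev.map_comp, Category.assoc, Category.assoc, reassoc_of% h,
      ← ev.map_comp, θ.inv_hom_id, ev.map_id]
  s₀_comp_δ₁ := by
    change (τ _ ≫ ev.map (P.map (D.cechCons 0))) ≫ ev.map (P.map (D.cech.δ 1)) =
      (ev.map (P.map (toPoint _) ≫ θ.hom) ≫ 𝟙 _) ≫
        ev.map θ.inv ≫ τ point ≫ ev.map (P.map D.cechVertex)
    have h : ev.map (P.map (toPoint (D.cech.obj (op (SimplexCategory.mk 0)))) ≫ θ.hom) ≫
        ev.map θ.inv = ev.map (P.map (toPoint _)) := by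
      rw [← ev.map_comp, Category.assoc, θ.hom_inv_id, Category.comp_id]
    rw [Category.comp_id, Category.assoc, ← ev.map_comp, ← P.map_comp, cechCons_zero_comp_δ_one,
      P.map_comp, ev.map_comp, ← Category.assoc, hτ, reassoc_of% h, Category.assoc]
  s_comp_δ₀ n := by
    change (τ _ ≫ ev.map (P.map (D.cechCons n))) ≫ ev.map (P.map (D.cech.δ 0)) = 𝟙 _
    rw [Category.assoc, ← ev.map_comp, ← P.map_comp, cechCons_comp_δ_zero]
    exact hτ' _
  s_comp_δ n i := by
    change (τ _ ≫ ev.map (P.map (D.cechCons (n + 1)))) ≫ ev.map (P.map (D.cech.δ i.succ)) =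
      ev.map (P.map (D.cech.δ i)) ≫ τ _ ≫ ev.map (P.map (D.cechCons n))
    rw [Category.assoc, ← ev.map_comp, ← P.map_comp, cechCons_comp_δ_succ, P.map_comp,
      ev.map_comp, ← Category.assoc, hτ, Category.assoc]
  s_comp_σ n i := by
    change (τ _ ≫ ev.map (P.map (D.cechCons n))) ≫ ev.map (P.map (D.cech.σ i.succ)) =
      ev.map (P.map (D.cech.σ i)) ≫ τ _ ≫ ev.map (P.map (D.cechCons (n + 1)))
    rw [Category.assoc, ← ev.map_comp, ← P.map_comp, cechCons_comp_σ_succ, P.map_comp,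
      ev.map_comp, ← Category.assoc, hτ, Category.assoc]

end Augmented

end GSetCat

end GSets

/-! ### Orbit decompositions -/

section OrbitDecomposition

variable {G : Type u} [Group G] (F : FiniteSubgroupFamily G)

/-- A decomposition of a `G`-set into orbits of the form `G ⧸ H` with `H` in the family. -/
structure OrbitDecomposition (X : GSetCat G) where
  ι : Type u
  stab : ι → F.Mem
  incl : ∀ i, (G ⧸ (stab i).1) →[G] X.carrier
  bijective : Function.Bijective fun p : Σ i, G ⧸ (stab i).1 => incl p.1 p.2

namespace OrbitDecomposition

/-- A `G`-set with stabilizers in the family has an orbit decomposition. -/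
noncomputable def ofStabilizers (X : GSetCat G)
    (hX : ∀ x : X.carrier, MulAction.stabilizer G x ∈ F.carrier) : OrbitDecomposition F X where
  ι := MulAction.orbitRel.Quotient G X.carrier
  stab ω := ⟨MulAction.stabilizer G ω.out, hX _⟩
  incl ω := ⟨MulAction.ofQuotientStabilizer G ω.out, fun g y =>
    MulAction.ofQuotientStabilizer_smul G ω.out g y⟩
  bijective := by
    have hmk : ∀ (ω : MulAction.orbitRel.Quotient G X.carrier)
        (y : G ⧸ MulAction.stabilizer G ω.out),
        (Quotient.mk'' (MulAction.ofQuotientStabilizer G ω.out y) :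
          MulAction.orbitRel.Quotient G X.carrier) = ω := fun ω y => by
      conv_rhs => rw [← Quotient.out_eq' ω]
      exact Quotient.sound' (MulAction.ofQuotientStabilizer_mem_orbit G ω.out y)
    constructor
    · rintro ⟨ω, y⟩ ⟨ω', y'⟩ h
      obtain rfl : ω = ω' := by
        rw [← hmk ω y, ← hmk ω' y']
        exact congrArg _ h
      exact congrArg _ (MulAction.injective_ofQuotientStabilizer G ω.out h)
    · intro x
      obtain ⟨g, hg⟩ : x ∈ MulAction.orbit G
          (Quotient.mk'' x : MulAction.orbitRel.Quotient G X.carrier).out :=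
        MulAction.orbitRel_apply.1 (Quotient.exact' (Quotient.out_eq' (Quotient.mk'' x)).symm)
      exact ⟨⟨Quotient.mk'' x, QuotientGroup.mk g⟩, hg⟩

variable {F} {X : GSetCat G} (d : OrbitDecomposition F X)

lemma incl_injective (i : d.ι) : Function.Injective (d.incl i) := fun y y' h => by
  have := d.bijective.1 (a₁ := ⟨i, y⟩) (a₂ := ⟨i, y'⟩) h
  exact eq_of_heq (Sigma.mk.inj this).2

lemma eq_of_incl_eq {i j : d.ι} {y : G ⧸ (d.stab i).1} {y' : G ⧸ (d.stab j).1}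
    (h : d.incl i y = d.incl j y') : i = j :=
  congrArg Sigma.fst (d.bijective.1 (a₁ := ⟨i, y⟩) (a₂ := ⟨j, y'⟩) h)

/-- A `G`-map from a transitive `G`-set factors uniquely through one of the orbits. -/
lemma comp_bijective (H : Subgroup G) : Function.Bijective
    fun p : Σ i, (G ⧸ H) →[G] (G ⧸ (d.stab i).1) => (d.incl p.1).comp p.2 := by
  constructor
  · rintro ⟨i, f⟩ ⟨j, g⟩ h
    have h' : ∀ x, d.incl i (f x) = d.incl j (g x) := fun x => DFunLike.congr_fun h x
    obtain rfl : i = j := d.eq_of_incl_eq (h' (QuotientGroup.mk 1))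
    obtain rfl : f = g := MulActionHom.ext fun x => d.incl_injective i (h' x)
    rfl
  · intro f
    -- The orbit is the one containing the image of the base coset; by transitivity the whole image
    -- of `f` lies in it.
    obtain ⟨⟨i, y⟩, hy⟩ := d.bijective.2 (f (QuotientGroup.mk 1))
    have hex : ∀ x, ∃ z, d.incl i z = f x := fun x => by
      obtain ⟨g, rfl⟩ := QuotientGroup.mk_surjective x
      refine ⟨g • y, ?_⟩
      rw [map_smul]
      refine (congrArg (g • ·) hy).trans ?_
      rw [← map_smul, MulAction.Quotient.smul_mk, smul_eq_mul, mul_one]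
    choose f' hf' using hex
    refine ⟨⟨i, ⟨f', fun g x => d.incl_injective i ?_⟩⟩, MulActionHom.ext hf'⟩
    rw [hf', map_smul, map_smul, hf']
    rfl

end OrbitDecomposition

end OrbitDecomposition

/-! ### Permutation modules -/

section PermModules

variable (R : Type u) [CommRing R] {G : Type u} [Group G]

/-- The permutation module of a `G`-set. -/
noncomputable abbrev permRep (X : GSetCat G) : Rep.{u} R G := Rep.ofMulAction R G X.carrier

variable {R} {X : GSetCat G} {V : Rep.{u} R G}

lemma permRep_hom_ext {f g : permRep R X ⟶ V}
    (h : ∀ x, f.hom (MonoidAlgebra.single x (1 : R)) = g.hom (MonoidAlgebra.single x (1 : R))) :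
    f = g :=
  Rep.hom_ext (Representation.IntertwiningMap.toLinearMap_injective _ _
    (MonoidAlgebra.lhom_ext' fun x => LinearMap.ext_ring (h x)))

/-- The `R`-linear extension of a map defined on the basis of `R[X]`. -/
noncomputable def linearExtension {X V : Type u} [AddCommGroup V] [Module R V] (c : X → V) :
    MonoidAlgebra R X →ₗ[R] V :=
  Finsupp.linearCombination R c ∘ₗ (MonoidAlgebra.coeffLinearEquiv R).toLinearMap

@[simp]
lemma linearExtension_single {X V : Type u} [AddCommGroup V] [Module R V] (c : X → V)
    (x : X) (r : R) : linearExtension c (MonoidAlgebra.single x r) = r • c x := by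
  simp [linearExtension]

/-- The map of `RG`-modules `R[X] → V` extending a `G`-equivariant map `X → V`. -/
noncomputable def permRepLift (c : X.carrier → V) (hc : ∀ (g : G) x, c (g • x) = V.ρ g (c x)) :
    permRep R X ⟶ V :=
  Rep.ofHom ⟨linearExtension c, fun g => by
    refine MonoidAlgebra.lhom_ext' fun x => LinearMap.ext_ring ?_
    simp only [LinearMap.comp_apply, MonoidAlgebra.lsingle_apply,
      Representation.ofMulAction_single, linearExtension_single, one_smul, hc]⟩

lemma permRepLift_single (c : X.carrier → V) (hc : ∀ (g : G) x, c (g • x) = V.ρ g (c x)) (x) :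
    (permRepLift c hc).hom (MonoidAlgebra.single x (1 : R)) = c x :=
  (linearExtension_single c x 1).trans (one_smul _ _)

variable (R) in
/-- The linearization of a map of `G`-sets. -/
noncomputable def permRepMap {X Y : GSetCat G} (f : X ⟶ Y) : permRep R X ⟶ permRep R Y :=
  permRepLift (fun x => MonoidAlgebra.single (GSetCat.Hom.toGMap f x) (1 : R)) fun g x => by
    rw [map_smul]
    exact (Representation.ofMulAction_single g _ _).symm

lemma permRepMap_single {X Y : GSetCat G} (f : X ⟶ Y) (x : X.carrier) :
    (permRepMap R f).hom (MonoidAlgebra.single x (1 : R)) =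
      MonoidAlgebra.single (GSetCat.Hom.toGMap f x) (1 : R) :=
  permRepLift_single _ _ x

variable (R) in
/-- The linearization functor from `G`-sets to `RG`-modules. -/
noncomputable def permRepFunctor : GSetCat G ⥤ Rep.{u} R G where
  obj X := permRep R X
  map f := permRepMap R f
  map_id _ := permRep_hom_ext fun x => permRepMap_single _ x
  map_comp f g := permRep_hom_ext fun x => (permRepMap_single _ x).trans
    ((congrArg (permRepMap R g).hom (permRepMap_single f x)).trans (permRepMap_single g _)).symm

end PermModules

/-! ### Splitting a permutation module along its orbits -/

section Transitive

variable (R : Type u) [CommRing R] {G : Type u} [Group G] {F : FiniteSubgroupFamily G}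

/-- The `G`-set `G ⧸ H`. -/
abbrev transitiveGSet (H : F.Mem) : GSetCat G where
  carrier := G ⧸ H.1

variable {R} in
lemma permModule_hom_ext {H : F.Mem} {V : Rep.{u} R G} {f g : permModule R F H ⟶ V}
    (h : f.hom (MonoidAlgebra.single (QuotientGroup.mk (1 : G)) (1 : R)) =
      g.hom (MonoidAlgebra.single (QuotientGroup.mk (1 : G)) (1 : R))) : f = g :=
  (fixedPointModule_eval_bijective R V H).1 h

namespace OrbitDecomposition

variable {X : GSetCat G} (d : OrbitDecomposition F X)

/-- The inclusion of an orbit, linearized. -/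
noncomputable def linIncl (i : d.ι) : permModule R F (d.stab i) ⟶ permRep R X :=
  permRepMap R (X := transitiveGSet (d.stab i)) (GSetCat.homMk (d.incl i))

/-- The projection of a permutation module to the summand given by an orbit. -/
noncomputable def proj (i : d.ι) : permRep R X ⟶ permModule R F (d.stab i) :=
  Rep.ofHom ⟨(MonoidAlgebra.coeffLinearEquiv R).symm.toLinearMap ∘ₗ
    Finsupp.lcomapDomain (d.incl i) (d.incl_injective i) ∘ₗ
    (MonoidAlgebra.coeffLinearEquiv R).toLinearMap, fun g => by
      refine LinearMap.ext fun v => MonoidAlgebra.ext (Finsupp.ext fun y => ?_)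
      change ((permRep R X).ρ g v).coeff (d.incl i y) = _
      refine (Representation.coeff_ofMulAction g v _).trans
        (Eq.trans ?_ (Representation.coeff_ofMulAction g _ y).symm)
      rw [← map_smul]
      rfl⟩

lemma linIncl_single (i : d.ι) (y : G ⧸ (d.stab i).1) :
    (d.linIncl R i).hom (MonoidAlgebra.single y (1 : R)) = MonoidAlgebra.single (d.incl i y) 1 :=
  permRepMap_single (X := transitiveGSet (d.stab i)) (GSetCat.homMk (d.incl i)) y

lemma proj_single_self (i : d.ι) (y : G ⧸ (d.stab i).1) :
    (d.proj R i).hom (MonoidAlgebra.single (d.incl i y) (1 : R)) = MonoidAlgebra.single y 1 := by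
  classical
  refine MonoidAlgebra.ext (Finsupp.ext fun z => ?_)
  change (MonoidAlgebra.single (d.incl i y) (1 : R)).coeff (d.incl i z) = _
  simp [Finsupp.single_apply, (d.incl_injective i).eq_iff]

lemma proj_single_of_ne {i j : d.ι} (hij : i ≠ j) (y : G ⧸ (d.stab i).1) :
    (d.proj R j).hom (MonoidAlgebra.single (d.incl i y) (1 : R)) = 0 := by
  classical
  refine MonoidAlgebra.ext (Finsupp.ext fun z => ?_)
  change (MonoidAlgebra.single (d.incl i y) (1 : R)).coeff (d.incl j z) = _
  simp [mt d.eq_of_incl_eq hij]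

lemma linIncl_proj_self (i : d.ι) : d.linIncl R i ≫ d.proj R i = 𝟙 _ :=
  permRep_hom_ext (X := transitiveGSet (d.stab i)) fun y => by
    refine (congrArg _ (d.linIncl_single R i y)).trans (d.proj_single_self R i y)

lemma linIncl_proj_of_ne {i j : d.ι} (hij : i ≠ j) : d.linIncl R i ≫ d.proj R j = 0 :=
  permRep_hom_ext (X := transitiveGSet (d.stab i)) fun y => by
    refine (congrArg _ (d.linIncl_single R i y)).trans (d.proj_single_of_ne R hij y)

/-- This is the decomposition of `R[X]` as the direct sum of the `R[G/H_i]`. Finiteness is proved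
along with the formula because additivity of `∑ᶠ` depends on it. -/
lemma finite_proj_and_finsum (v : permRep R X) :
    {i | (d.proj R i).hom v ≠ 0}.Finite ∧
      ∑ᶠ i, (d.linIncl R i).hom ((d.proj R i).hom v) = v := by
  induction v using MonoidAlgebra.induction_linear with
  | zero => simp
  | add v w hv hw =>
    have hsub : ∀ u : permRep R X, (Function.support fun i =>
        (d.linIncl R i).hom ((d.proj R i).hom u)) ⊆ {i | (d.proj R i).hom u ≠ 0} :=
      fun u i hi h => hi (by simp [h])
    refine ⟨(hv.1.union hw.1).subset fun i hi => ?_, ?_⟩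
    · by_contra hcon
      simp only [Set.mem_union, Set.mem_ofPred_eq, not_or, not_not] at hcon
      exact hi (by rw [map_add, hcon.1, hcon.2, add_zero])
    · simp only [map_add]
      rw [finsum_add_distrib (hv.1.subset (hsub v)) (hw.1.subset (hsub w)), hv.2, hw.2]
  | single x r =>
    obtain ⟨⟨i, y⟩, rfl⟩ := d.bijective.2 x
    have hr : (MonoidAlgebra.single (d.incl i y) r : permRep R X) =
        r • MonoidAlgebra.single (d.incl i y) (1 : R) := by simp
    have hne : ∀ j, j ≠ i → (d.proj R j).hom (MonoidAlgebra.single (d.incl i y) r) = 0 :=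
      fun j hj => by rw [hr, map_smul, d.proj_single_of_ne R hj.symm, smul_zero]
    refine ⟨(Set.finite_singleton i).subset fun j hj => ?_, ?_⟩
    · by_contra hji
      exact hj (hne j hji)
    · dsimp only
      rw [finsum_eq_single _ i fun j hj => by rw [hne j hj, map_zero], hr, map_smul, map_smul,
        d.proj_single_self R, d.linIncl_single R]

/-- The image of the coset `H` generates the image of `φ` and has components in only finitely many
orbits. This compactness of `R[G/H]` lets a map into `R[X]` be split over infinitely many orbits. -/
lemma finite_comp_proj {H : F.Mem} (φ : permModule R F H ⟶ permRep R X) :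
    {i | φ ≫ d.proj R i ≠ 0}.Finite := by
  refine (d.finite_proj_and_finsum R
    (φ.hom (MonoidAlgebra.single (QuotientGroup.mk (1 : G)) (1 : R)))).1.subset fun i hi h => hi ?_
  exact permModule_hom_ext h

lemma finsum_comp_proj {H : F.Mem} (φ : permModule R F H ⟶ permRep R X) :
    ∑ᶠ i, (φ ≫ d.proj R i) ≫ d.linIncl R i = φ := by
  -- Evaluation at the generator is additive and injective, so the identity of maps reduces to one
  -- of vectors.
  let e : (permModule R F H ⟶ permRep R X) →+ permRep R X :=
    { toFun := fun ψ => ψ.hom (MonoidAlgebra.single (QuotientGroup.mk (1 : G)) (1 : R))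
      map_zero' := rfl
      map_add' := fun _ _ => rfl }
  refine permModule_hom_ext (?_ : e _ = e φ)
  rw [AddMonoidHom.map_finsum]
  · exact (d.finite_proj_and_finsum R _).2
  · refine (d.finite_comp_proj R φ).subset fun i hi h => hi ?_
    dsimp only
    rw [h, zero_comp]

end OrbitDecomposition

end Transitive

/-! ### Modules over the orbit category and the Hecke category attached to `G`-sets -/

section Modules

variable (R : Type u) [CommRing R] {G : Type u} [Group G] (F : FiniteSubgroupFamily G)

/-- The inclusion of the orbit category into the category of `G`-sets. -/
def orbitToGSet : OrbitCategory F ⥤ GSetCat G where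
  obj K := transitiveGSet K.stab
  map f := GSetCat.homMk (OrbitCategory.Hom.toGMap f)

/-- The functor sending a `G`-set `X` to the module `G/K ↦ R[Hom_G(G/K, X)]` over the orbit
category. -/
noncomputable def orbitPerm : GSetCat G ⥤ OrbitModule R F :=
  yoneda ⋙ (Functor.whiskeringLeft _ _ _).obj (orbitToGSet F).op ⋙
    (Functor.whiskeringRight _ _ _).obj (ModuleCat.free R)

/-- The fixed point functor `M ↦ M^-`. -/
noncomputable def fixedPointFunctor : Rep.{u} R G ⥤ HeckeModule R F where
  obj M := fixedPointModule R F M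
  map f := ObjectProperty.homMk
    (Functor.whiskerLeft (inducedFunctor (permModule R F)).op ((linearYoneda R (Rep.{u} R G)).map f))
  map_id M := by
    refine ObjectProperty.hom_ext _ ?_
    simp only [CategoryTheory.Functor.map_id]
    rfl
  map_comp f g := by
    refine ObjectProperty.hom_ext _ ?_
    simp only [Functor.map_comp]
    rfl

/-- The functor sending a `G`-set `X` to the fixed point functor of `R[X]`. -/
noncomputable def heckePerm : GSetCat G ⥤ HeckeModule R F :=
  permRepFunctor R ⋙ fixedPointFunctor R F

variable {R F}

/-- A map of `G`-sets from `G ⧸ K` as a basis element of the value of `orbitPerm`. -/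
noncomputable def orbitPermMk {X : GSetCat G} {K : F.Mem} (f : (G ⧸ K.1) →[G] X.carrier) :
    ((orbitPerm R F).obj X).obj (op ⟨K⟩) :=
  ModuleCat.freeMk (R := R) (X := transitiveGSet K ⟶ X) (GSetCat.homMk f)

lemma orbitPerm_map_mk {X Y : GSetCat G} (g : X ⟶ Y) {K : F.Mem}
    (f : (G ⧸ K.1) →[G] X.carrier) :
    ((orbitPerm R F).map g).app (op ⟨K⟩) (orbitPermMk f) =
      orbitPermMk ((GSetCat.Hom.toGMap g).comp f) :=
  ModuleCat.free_map_apply _ _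

lemma orbitPerm_obj_map_mk {X : GSetCat G} {K L : OrbitCategory F} (g : L ⟶ K)
    (f : (G ⧸ K.stab.1) →[G] X.carrier) :
    ((orbitPerm R F).obj X).map g.op (orbitPermMk f) =
      orbitPermMk (f.comp (OrbitCategory.Hom.toGMap g)) :=
  ModuleCat.free_map_apply _ _

/-- A linear map out of a value of `orbitPerm`. -/
noncomputable def orbitPermDesc {X : GSetCat G} {K : OrbitCategory F} {V : ModuleCat.{u} R}
    (c : ((G ⧸ K.stab.1) →[G] X.carrier) → V) :
    ((orbitPerm R F).obj X).obj (op K) ⟶ V :=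
  ModuleCat.freeDesc (X := transitiveGSet K.stab ⟶ X) (↾c)

lemma orbitPermDesc_mk {X : GSetCat G} {K : OrbitCategory F} {V : ModuleCat.{u} R}
    (c : ((G ⧸ K.stab.1) →[G] X.carrier) → V) (f) :
    orbitPermDesc c (orbitPermMk f) = c f :=
  ModuleCat.freeDesc_apply _ _

lemma orbitPerm_obj_hom_ext {X : GSetCat G} {K : OrbitCategory F} {V : ModuleCat.{u} R}
    {a b : ((orbitPerm R F).obj X).obj (op K) ⟶ V}
    (h : ∀ f, a (orbitPermMk f) = b (orbitPermMk f)) : a = b :=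
  ModuleCat.free_hom_ext (X := transitiveGSet K.stab ⟶ X) h

/-- The natural transformation out of `orbitPerm` given by a natural family of maps. -/
noncomputable def orbitPermHomMk {X : GSetCat G} {N : OrbitModule R F}
    (c : ∀ K : OrbitCategory F, ((G ⧸ K.stab.1) →[G] X.carrier) → N.obj (op K))
    (hc : ∀ {K L : OrbitCategory F} (g : L ⟶ K) (f : (G ⧸ K.stab.1) →[G] X.carrier),
      c L (f.comp (OrbitCategory.Hom.toGMap g)) = N.map g.op (c K f)) :
    (orbitPerm R F).obj X ⟶ N where
  app K := orbitPermDesc (K := K.unop) (c K.unop)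
  naturality {K L} g := orbitPerm_obj_hom_ext (K := K.unop) fun f => by
    rw [ModuleCat.comp_apply, ModuleCat.comp_apply, orbitPermDesc_mk]
    exact (congrArg (orbitPermDesc (K := L.unop) (c L.unop)) (orbitPerm_obj_map_mk g.unop f)).trans
      ((orbitPermDesc_mk _ _).trans (hc g.unop f))

lemma orbitPermHomMk_app_mk {X : GSetCat G} {N : OrbitModule R F}
    (c : ∀ K : OrbitCategory F, ((G ⧸ K.stab.1) →[G] X.carrier) → N.obj (op K))
    (hc : ∀ {K L : OrbitCategory F} (g : L ⟶ K) (f : (G ⧸ K.stab.1) →[G] X.carrier),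
      c L (f.comp (OrbitCategory.Hom.toGMap g)) = N.map g.op (c K f)) (K : OrbitCategory F) (f) :
    (orbitPermHomMk c hc).app (op K) (orbitPermMk f) = c K f :=
  orbitPermDesc_mk _ _

lemma orbitPerm_hom_ext {X : GSetCat G} {N : OrbitModule R F}
    {α β : (orbitPerm R F).obj X ⟶ N}
    (h : ∀ (K : OrbitCategory F) (f : (G ⧸ K.stab.1) →[G] X.carrier),
      α.app (op K) (orbitPermMk f) = β.app (op K) (orbitPermMk f)) : α = β :=
  NatTrans.ext (funext fun K => orbitPerm_obj_hom_ext (K := K.unop) (h K.unop))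

/-- Naturality of a map out of `orbitPerm` on basis elements. -/
lemma orbitPerm_hom_comp {X : GSetCat G} {N : OrbitModule R F} (α : (orbitPerm R F).obj X ⟶ N)
    {K L : OrbitCategory F} (g : L ⟶ K) (f : (G ⧸ K.stab.1) →[G] X.carrier) :
    α.app (op L) (orbitPermMk (f.comp (OrbitCategory.Hom.toGMap g))) =
      N.map g.op (α.app (op K) (orbitPermMk f)) := by
  rw [← orbitPerm_obj_map_mk]
  exact ConcreteCategory.congr_hom (α.naturality g.op) (orbitPermMk f)

/-- The action of a morphism of the Hecke category on a module. -/
noncomputable def heckeAct (M : HeckeModule R F) {K L : F.Mem}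
    (ψ : permModule R F L ⟶ permModule R F K) :
    M.obj.obj (op K) →ₗ[R] M.obj.obj (op L) :=
  (M.obj.map (InducedCategory.homMk (F := permModule R F) (X := L) (Y := K) ψ).op).hom

/-- Linearity of Hecke modules enters here and in `heckeAct_smul`. It is what allows a map out of
`heckePerm X` to be recovered from its values on `G`-maps alone. -/
lemma heckeAct_add (M : HeckeModule R F) {K L : F.Mem}
    (ψ ψ' : permModule R F L ⟶ permModule R F K) :
    heckeAct M (ψ + ψ') = heckeAct M ψ + heckeAct M ψ' :=
  congrArg ModuleCat.Hom.hom (M.property.1 L K (InducedCategory.homMk ψ) (InducedCategory.homMk ψ'))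

lemma heckeAct_smul (M : HeckeModule R F) {K L : F.Mem} (r : R)
    (ψ : permModule R F L ⟶ permModule R F K) :
    heckeAct M (r • ψ) = r • heckeAct M ψ :=
  congrArg ModuleCat.Hom.hom (M.property.2 L K r (InducedCategory.homMk ψ))

lemma heckeAct_zero (M : HeckeModule R F) {K L : F.Mem} :
    heckeAct M (0 : permModule R F L ⟶ permModule R F K) = 0 := by
  rw [← zero_smul R (0 : permModule R F L ⟶ permModule R F K), heckeAct_smul, zero_smul]

lemma heckeAct_id (M : HeckeModule R F) {K : F.Mem} (m : M.obj.obj (op K)) :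
    heckeAct M (𝟙 (permModule R F K)) m = m :=
  ConcreteCategory.congr_hom (M.obj.map_id (op K)) m

lemma heckeAct_comp (M : HeckeModule R F) {J K L : F.Mem}
    (ψ : permModule R F L ⟶ permModule R F K) (χ : permModule R F J ⟶ permModule R F L)
    (m : M.obj.obj (op K)) :
    heckeAct M (χ ≫ ψ) m = heckeAct M χ (heckeAct M ψ m) :=
  ConcreteCategory.congr_hom (M.obj.map_comp
    (InducedCategory.homMk (F := permModule R F) (X := L) (Y := K) ψ).op
    (InducedCategory.homMk (F := permModule R F) (X := J) (Y := L) χ).op) m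

variable {X : GSetCat G} {M : HeckeModule R F}

/-- A map out of `heckePerm`, evaluated at a transitive `G`-set. -/
noncomputable def heckePermEval (α : (heckePerm R F).obj X ⟶ M) (K : F.Mem) :
    (permModule R F K ⟶ permRep R X) →ₗ[R] M.obj.obj (op K) :=
  (α.hom.app (op K)).hom

lemma heckePermEval_comp (α : (heckePerm R F).obj X ⟶ M) {K L : F.Mem}
    (ψ : permModule R F L ⟶ permModule R F K) (φ : permModule R F K ⟶ permRep R X) :
    heckePermEval α L (ψ ≫ φ) = heckeAct M ψ (heckePermEval α K φ) :=
  ConcreteCategory.congr_hom (α.hom.naturality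
    (InducedCategory.homMk (F := permModule R F) (X := L) (Y := K) ψ).op) φ

/-- Constructor for maps out of `heckePerm`. -/
noncomputable def heckePermHomMk
    (c : ∀ K : F.Mem, (permModule R F K ⟶ permRep R X) →ₗ[R] M.obj.obj (op K))
    (hc : ∀ {K L : F.Mem} (ψ : permModule R F L ⟶ permModule R F K)
      (φ : permModule R F K ⟶ permRep R X), c L (ψ ≫ φ) = heckeAct M ψ (c K φ)) :
    (heckePerm R F).obj X ⟶ M :=
  ObjectProperty.homMk
    { app := fun K => ModuleCat.ofHom (c K.unop)
      naturality := fun _ _ ψ => ModuleCat.hom_ext (LinearMap.ext fun φ => hc ψ.unop.hom φ) }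

lemma heckePerm_hom_ext {α β : (heckePerm R F).obj X ⟶ M}
    (h : ∀ (K : F.Mem) (φ : permModule R F K ⟶ permRep R X),
      heckePermEval α K φ = heckePermEval β K φ) : α = β :=
  ObjectProperty.hom_ext _ (NatTrans.ext (funext fun K =>
    ModuleCat.hom_ext (LinearMap.ext (h K.unop))))

/-! ### Universal properties -/

/-- The linearization of a `G`-map out of a transitive `G`-set. -/
noncomputable abbrev transitiveMap {K : F.Mem} (f : (G ⧸ K.1) →[G] X.carrier) :
    permModule R F K ⟶ permRep R X :=
  permRepMap R (X := transitiveGSet K) (GSetCat.homMk f)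

variable (d : OrbitDecomposition F X)

/-- Maps out of `orbitPerm X` are freely determined by their values on the orbits of `X`. -/
lemma orbitPerm_eval_bijective (N : OrbitModule R F) : Function.Bijective
    fun (α : (orbitPerm R F).obj X ⟶ N) (i : d.ι) =>
      α.app (op ⟨d.stab i⟩) (orbitPermMk (d.incl i)) := by
  constructor
  · intro α β h
    refine orbitPerm_hom_ext fun K f => ?_
    -- Since `f` factors through an orbit inclusion, naturality expresses the value at `f` by the
    -- value at that inclusion.
    obtain ⟨⟨i, f'⟩, rfl⟩ := (d.comp_bijective K.stab.1).2 f
    have h1 := orbitPerm_hom_comp α (K := ⟨d.stab i⟩) (L := K) f' (d.incl i)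
    have h2 := orbitPerm_hom_comp β (K := ⟨d.stab i⟩) (L := K) f' (d.incl i)
    exact h1.trans ((congrArg _ (congrFun h i)).trans h2.symm)
  · intro n
    let e := fun K : OrbitCategory F => Equiv.ofBijective _ (d.comp_bijective K.stab.1)
    let c : ∀ (K : OrbitCategory F), (Σ i, (G ⧸ K.stab.1) →[G] (G ⧸ (d.stab i).1)) →
      N.obj (op K) := fun K p =>
        N.map (Quiver.Hom.op (X := K) (Y := (⟨d.stab p.1⟩ : OrbitCategory F)) p.2) (n p.1)
    refine ⟨orbitPermHomMk (fun K f => c K ((e K).symm f)) ?_, funext fun i => ?_⟩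
    · intro K L g f
      obtain ⟨p, rfl⟩ := (e K).surjective f
      have : ((e K) p).comp (OrbitCategory.Hom.toGMap g) =
        e L ⟨p.1, p.2.comp (OrbitCategory.Hom.toGMap g)⟩ := rfl
      rw [this, Equiv.symm_apply_apply, Equiv.symm_apply_apply]
      exact ConcreteCategory.congr_hom (N.map_comp
        (Quiver.Hom.op (X := K) (Y := (⟨d.stab p.1⟩ : OrbitCategory F)) p.2) g.op) (n p.1)
    · refine (orbitPermHomMk_app_mk _ _ _ _).trans ?_
      have : d.incl i = e ⟨d.stab i⟩ ⟨i, MulActionHom.id G⟩ := rfl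
      rw [this, Equiv.symm_apply_apply]
      exact ConcreteCategory.congr_hom (N.map_id _) (n i)

/-- Maps out of `heckePerm X` are freely determined by their values on the orbits of `X`. -/
lemma heckePerm_eval_bijective (M : HeckeModule R F) : Function.Bijective
    fun (α : (heckePerm R F).obj X ⟶ M) (i : d.ι) =>
      heckePermEval α (d.stab i) (transitiveMap (d.incl i)) := by
  have hfin : ∀ {K : F.Mem} (φ : permModule R F K ⟶ permRep R X)
      (n : ∀ i, M.obj.obj (op (d.stab i))),
      (Function.support fun i => heckeAct M (φ ≫ d.proj R i) (n i)).Finite := fun φ n =>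
    (d.finite_comp_proj R φ).subset fun i hi h => hi (by
      dsimp only
      rw [h, heckeAct_zero, LinearMap.zero_apply])
  -- Write `φ` as the finite sum of the `(φ ≫ proj i) ≫ incl i`, then use additivity and naturality
  -- of `α`.
  have key : ∀ (α : (heckePerm R F).obj X ⟶ M) (K : F.Mem)
      (φ : permModule R F K ⟶ permRep R X), heckePermEval α K φ =
      ∑ᶠ i, heckeAct M (φ ≫ d.proj R i) (heckePermEval α (d.stab i) (d.linIncl R i)) := by
    intro α K φ
    conv_lhs => rw [← d.finsum_comp_proj R φ]
    refine (AddMonoidHom.map_finsum (heckePermEval α K).toAddMonoidHom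
      ((d.finite_comp_proj R φ).subset fun i hi h => hi ?_)).trans ?_
    · rw [h, zero_comp]
    · exact finsum_congr fun i => heckePermEval_comp α _ _
  constructor
  · intro α β h
    refine heckePerm_hom_ext fun K φ => ?_
    rw [key, key]
    exact finsum_congr fun i => congrArg _ (congrFun h i)
  · intro n
    -- The formula is forced by `key`.
    refine ⟨heckePermHomMk (fun K =>
      { toFun := fun φ => ∑ᶠ i, heckeAct M (φ ≫ d.proj R i) (n i)
        map_add' := fun φ φ' => ?_
        map_smul' := fun r φ => ?_ }) ?_, funext fun i => ?_⟩
    · rw [← finsum_add_distrib (hfin φ n) (hfin φ' n)]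
      exact finsum_congr fun i => by
        rw [Preadditive.add_comp, heckeAct_add, LinearMap.add_apply]
    · rw [RingHom.id_apply, smul_finsum' r (hfin φ n)]
      exact finsum_congr fun i => by
        rw [CategoryTheory.Linear.smul_comp, heckeAct_smul, LinearMap.smul_apply]
    · intro K L ψ φ
      refine Eq.trans ?_ (AddMonoidHom.map_finsum (heckeAct M ψ).toAddMonoidHom (hfin φ n)).symm
      exact finsum_congr fun i => by
        rw [Category.assoc, heckeAct_comp]
        rfl
    · change ∑ᶠ j, heckeAct M (d.linIncl R i ≫ d.proj R j) (n j) = n i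
      rw [finsum_eq_single _ i fun j hj => by
        rw [d.linIncl_proj_of_ne R hj.symm, heckeAct_zero, LinearMap.zero_apply],
        d.linIncl_proj_self R, heckeAct_id]

/-! ### Comparison -/

/-- Precomposition with a `G`-map becomes the Hecke action through `π ∘ σ`; this is what makes
`restrictHom` natural over the orbit category. -/
lemma transitiveMap_comp {K L : OrbitCategory F} (g : L ⟶ K)
    (f : (G ⧸ K.stab.1) →[G] X.carrier) :
    transitiveMap (R := R) (f.comp (OrbitCategory.Hom.toGMap g)) =
      ((orbitToHecke R F).map g).hom ≫ transitiveMap f :=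
  permRep_hom_ext (X := transitiveGSet L.stab) fun x =>
    (permRepMap_single (X := transitiveGSet L.stab) _ x).trans
      ((congrArg (transitiveMap (R := R) f).hom
        (MackeySpan.pi_sigma_single R (OrbitCategory.Hom.toGMap g) x 1)).trans
          (permRepMap_single (X := transitiveGSet K.stab) _ _)).symm

lemma heckePermEval_transitiveMap_comp (α : (heckePerm R F).obj X ⟶ M) {K L : OrbitCategory F}
    (g : L ⟶ K) (f : (G ⧸ K.stab.1) →[G] X.carrier) :
    heckePermEval α L.stab (transitiveMap (f.comp (OrbitCategory.Hom.toGMap g))) =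
      (resOrbit R F M).map g.op (heckePermEval α K.stab (transitiveMap f)) := by
  rw [transitiveMap_comp]
  exact heckePermEval_comp α _ _

/-- Restricting a map out of `heckePerm X` to the orbit category and to the basis elements
coming from `G`-maps. -/
noncomputable def restrictHom (α : (heckePerm R F).obj X ⟶ M) :
    (orbitPerm R F).obj X ⟶ resOrbit R F M :=
  orbitPermHomMk (N := resOrbit R F M)
    (fun K f => heckePermEval α K.stab (transitiveMap f)) (heckePermEval_transitiveMap_comp α)

lemma restrictHom_app_mk (α : (heckePerm R F).obj X ⟶ M) (K : OrbitCategory F)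
    (f : (G ⧸ K.stab.1) →[G] X.carrier) :
    (restrictHom α).app (op K) (orbitPermMk f) = heckePermEval α K.stab (transitiveMap f) :=
  orbitPermHomMk_app_mk _ (heckePermEval_transitiveMap_comp α) _ _

/-- Evaluation at the orbit inclusions identifies both sides with the product of the `M(G/H_i)`. The
inclusions are `G`-maps, so restriction commutes with these evaluations and is bijective by
cancellation. -/
lemma restrictHom_bijective (d : OrbitDecomposition F X) : Function.Bijective
    (restrictHom : ((heckePerm R F).obj X ⟶ M) → ((orbitPerm R F).obj X ⟶ resOrbit R F M)) := by
  refine (Function.Bijective.of_comp_iff' (orbitPerm_eval_bijective d (resOrbit R F M)) _).1 ?_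
  have : (fun (α : (orbitPerm R F).obj X ⟶ resOrbit R F M) (i : d.ι) =>
      α.app (op ⟨d.stab i⟩) (orbitPermMk (d.incl i))) ∘ restrictHom =
      fun (α : (heckePerm R F).obj X ⟶ M) (i : d.ι) =>
        heckePermEval α (d.stab i) (transitiveMap (d.incl i)) :=
    funext fun α => funext fun i => restrictHom_app_mk α ⟨d.stab i⟩ (d.incl i)
  rw [this]
  exact heckePerm_eval_bijective d M

/-- `restrictHom` as a linear equivalence. -/
noncomputable def restrictHomEquiv (d : OrbitDecomposition F X) (M : HeckeModule R F) :
    ((heckePerm R F).obj X ⟶ M) ≃ₗ[R] ((orbitPerm R F).obj X ⟶ resOrbit R F M) :=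
  LinearEquiv.ofBijective
    { toFun := restrictHom
      map_add' := fun α β => orbitPerm_hom_ext fun K f =>
        (restrictHom_app_mk (α + β) K f).trans (congrArg₂ (· + ·)
          (restrictHom_app_mk α K f) (restrictHom_app_mk β K f)).symm
      map_smul' := fun r α => orbitPerm_hom_ext fun K f =>
        (restrictHom_app_mk (r • α) K f).trans (congrArg (r • ·)
          (restrictHom_app_mk α K f)).symm } (restrictHom_bijective d)

lemma restrictHom_naturality {Y : GSetCat G} (g : X ⟶ Y) (α : (heckePerm R F).obj Y ⟶ M) :
    restrictHom ((heckePerm R F).map g ≫ α) =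
      (orbitPerm R F).map g ≫ restrictHom α :=
  orbitPerm_hom_ext fun K f => by
    rw [restrictHom_app_mk]
    refine Eq.symm ((congrArg ((restrictHom α).app (op K)) (orbitPerm_map_mk g f)).trans ?_)
    rw [restrictHom_app_mk]
    change heckePermEval α K.stab _ = heckePermEval α K.stab (transitiveMap f ≫ permRepMap R g)
    congr 1
    exact (permRepFunctor R).map_comp (X := transitiveGSet K.stab) (GSetCat.homMk f) g

end Modules

/-! ### Projectivity and exactness -/

section Resolutions

variable {R : Type u} [CommRing R] {G : Type u} [Group G] {F : FiniteSubgroupFamily G}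

/-- Epimorphisms are pointwise surjective, so the values on the orbits lift one by one, and any
choice of lifts extends to a map. -/
lemma orbitPerm_projective {X : GSetCat G} (d : OrbitDecomposition F X) :
    Projective ((orbitPerm R F).obj X) where
  factors {A B} f e he := by
    have hs : ∀ K, Function.Surjective (e.app K) := fun K =>
      (ModuleCat.epi_iff_surjective _).1 ((NatTrans.epi_iff_epi_app e).1 he K)
    choose a ha using fun i : d.ι => hs (op ⟨d.stab i⟩) (f.app _ (orbitPermMk (d.incl i)))
    obtain ⟨α, hα⟩ := (orbitPerm_eval_bijective d _).2 a
    refine ⟨α, (orbitPerm_eval_bijective d _).1 (funext fun i => ?_)⟩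
    exact (congrArg (e.app (op ⟨d.stab i⟩)) (congrFun hα i)).trans (ha i)

/-- The cokernel of `e` among all functors is a quotient of `N`, hence again `R`-linear. It
therefore vanishes, and `e` remains an epimorphism of functors. -/
lemma heckeModule_surjective_of_epi {M N : HeckeModule R F} (e : M ⟶ N) [Epi e]
    (K : (HeckeCategory R F)ᵒᵖ) : Function.Surjective (e.hom.app K) := by
  have := (linearPresheaf R (HeckeCategory R F)).preservesEpimorphisms_ι_of_isNormalMonoCategory
  have h : Epi ((linearPresheaf R (HeckeCategory R F)).ι.map e) := inferInstance
  exact (ModuleCat.epi_iff_surjective _).1 ((NatTrans.epi_iff_epi_app _).1 h K)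

lemma heckePerm_projective {X : GSetCat G} (d : OrbitDecomposition F X) :
    Projective ((heckePerm R F).obj X) where
  factors {A B} f e he := by
    choose a ha using fun i : d.ι => heckeModule_surjective_of_epi e (op (d.stab i))
      (heckePermEval f (d.stab i) (transitiveMap (d.incl i)))
    obtain ⟨α, hα⟩ := (heckePerm_eval_bijective d _).2 a
    refine ⟨α, (heckePerm_eval_bijective d _).1 (funext fun i => ?_)⟩
    exact (congrArg (e.hom.app (op (d.stab i))) (congrFun hα i)).trans (ha i)

variable (R F)

/-- Evaluation of modules over the orbit category. -/
abbrev orbitEval (K : OrbitCategory F) : OrbitModule R F ⥤ ModuleCat.{u} R :=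
  (evaluation _ _).obj (op K)

/-- Evaluation of modules over the Hecke category. -/
noncomputable abbrev heckeEval (K : F.Mem) : HeckeModule R F ⥤ ModuleCat.{u} R :=
  (linearPresheaf R (HeckeCategory R F)).ι ⋙
    (evaluation (HeckeCategory R F)ᵒᵖ (ModuleCat.{u} R)).obj (op K)

/-- Linear functors are closed under subobjects and quotients, so their kernels and cokernels are
computed pointwise. -/
instance (K : F.Mem) : (heckeEval R F K).PreservesHomology where
  preservesKernels _ _ f := by
    have := (linearPresheaf R (HeckeCategory R F)).preservesKernels_ι f
    infer_instance
  preservesCokernels _ _ f := by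
    have := (linearPresheaf R (HeckeCategory R F)).preservesCokernels_ι f
    infer_instance

lemma isIso_of_orbitEval {M N : OrbitModule R F} (f : M ⟶ N)
    (h : ∀ K, IsIso ((orbitEval R F K).map f)) : IsIso f := by
  rw [NatTrans.isIso_iff_isIso_app]
  exact fun K => h K.unop

lemma isIso_of_heckeEval {M N : HeckeModule R F} (f : M ⟶ N)
    (h : ∀ K, IsIso ((heckeEval R F K).map f)) : IsIso f := by
  have : IsIso ((linearPresheaf R (HeckeCategory R F)).ι.map f) := by
    rw [NatTrans.isIso_iff_isIso_app]
    exact fun K => h K.unop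
  exact isIso_of_reflects_iso f (linearPresheaf R (HeckeCategory R F)).ι

instance (K : OrbitCategory F) : Subsingleton ((orbitToGSet F).obj K ⟶ GSetCat.point) :=
  ⟨fun _ _ => GSetCat.hom_ext fun _ => rfl⟩

/-- The value of `orbitPerm` at the one-point `G`-set and a transitive `G`-set. -/
noncomputable def orbitPermPointEquiv (K : OrbitCategory F) :
    ((orbitPerm R F).obj GSetCat.point).obj (op K) ≃ₗ[R] R :=
  Finsupp.uniqueLinearEquiv (α := (orbitToGSet F).obj K ⟶ GSetCat.point) R R (GSetCat.toPoint ((orbitToGSet F).obj K))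

lemma orbitPermPointEquiv_mk (K : OrbitCategory F) (f) :
    orbitPermPointEquiv R F K (orbitPermMk f) = 1 :=
  Finsupp.single_eq_same

/-- The value of `orbitPerm` at the one-point `G`-set. -/
noncomputable def orbitPermPointIso :
    (orbitPerm R F).obj GSetCat.point ≅ constantOrbitModule R F :=
  NatIso.ofComponents (fun K => (orbitPermPointEquiv R F K.unop).toModuleIso)
    (fun {K L} g => orbitPerm_obj_hom_ext (K := K.unop) fun f =>
      (congrArg (orbitPermPointEquiv R F L.unop) (orbitPerm_obj_map_mk g.unop f)).trans
        ((orbitPermPointEquiv_mk R F _ _).trans (orbitPermPointEquiv_mk R F _ f).symm))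

/-- The value of `heckePerm` at the one-point `G`-set. -/
noncomputable def heckePermPointIso :
    (heckePerm R F).obj GSetCat.point ≅ trivialFixedPointModule R F :=
  (fixedPointFunctor R F).mapIso
    (@Rep.ofMulActionSubsingletonIsoTrivial R G _ _ PUnit _ _ GSetCat.point.action)

/-! ### Pointwise sections of the projections `D × X → X` -/

section Sections

variable {R F} (D : GSetCat G) {K : F.Mem} (δ : (G ⧸ K.1) →[G] D.carrier)

/-- The section of `orbitPerm (D × X) → orbitPerm X` at `G ⧸ K` given by a `G`-map `δ`. -/
noncomputable def orbitSection (X : GSetCat G) :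
    (orbitEval R F ⟨K⟩).obj ((orbitPerm R F).obj X) ⟶
      (orbitEval R F ⟨K⟩).obj ((orbitPerm R F).obj (D.prod X)) :=
  orbitPermDesc (K := ⟨K⟩) fun f => orbitPermMk (K := K) (X := D.prod X)
    ⟨fun x => (δ x, f x), fun g x => Prod.ext (map_smul δ g x) (map_smul f g x)⟩

lemma orbitSection_mk (X : GSetCat G) (f : (G ⧸ K.1) →[G] X.carrier) :
    orbitSection (R := R) D δ X (orbitPermMk f) = orbitPermMk (K := K) (X := D.prod X)
      ⟨fun x => (δ x, f x), fun g x => Prod.ext (map_smul δ g x) (map_smul f g x)⟩ :=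
  orbitPermDesc_mk (K := ⟨K⟩) _ f

lemma orbitSection_naturality {X Y : GSetCat G} (f : X ⟶ Y) :
    orbitSection (R := R) D δ X ≫ (orbitEval R F ⟨K⟩).map ((orbitPerm R F).map (D.prodMap f)) =
      (orbitEval R F ⟨K⟩).map ((orbitPerm R F).map f) ≫ orbitSection D δ Y :=
  orbitPerm_obj_hom_ext (K := ⟨K⟩) fun c =>
    (congrArg (((orbitPerm R F).map (D.prodMap f)).app (op ⟨K⟩))
      (orbitSection_mk D δ X c)).trans ((orbitPerm_map_mk _ _).trans
        ((congrArg (orbitSection (R := R) D δ Y) (orbitPerm_map_mk f c)).trans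
          (orbitSection_mk D δ Y _)).symm)

lemma orbitSection_comp (X : GSetCat G) :
    orbitSection (R := R) D δ X ≫
      (orbitEval R F ⟨K⟩).map ((orbitPerm R F).map (D.prodSnd X)) = 𝟙 _ :=
  orbitPerm_obj_hom_ext (K := ⟨K⟩) fun c =>
    (congrArg (((orbitPerm R F).map (D.prodSnd X)).app (op ⟨K⟩))
      (orbitSection_mk D δ X c)).trans (orbitPerm_map_mk _ _)

variable (R) in
/-- The linearization `R[X] → R[D × X]` of the map `x ↦ (d, x)`. -/
noncomputable def pairLinear (X : GSetCat G) (d : D.carrier) :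
    permRep R X →ₗ[R] permRep R (D.prod X) :=
  MonoidAlgebra.mapDomainLinearMap R R (fun x : X.carrier => (d, x))

lemma pairLinear_single (X : GSetCat G) (d : D.carrier) (x : X.carrier) :
    pairLinear R D X d (MonoidAlgebra.single x (1 : R)) =
      MonoidAlgebra.single ((d, x) : D.carrier × X.carrier) 1 :=
  MonoidAlgebra.mapDomain_single

/-- For fixed `d` the map `x ↦ (d, x)` need not be equivariant; the family is, once `G` also moves
`d`. This gives the equivariance of `pairHom`, where `d = δ y` varies with `y`. -/
lemma pairLinear_smul (X : GSetCat G) (d : D.carrier) (g : G) (v : permRep R X) :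
    pairLinear R D X (g • d) ((permRep R X).ρ g v) =
      (permRep R (D.prod X)).ρ g (pairLinear R D X d v) := by
  suffices h : pairLinear R D X (g • d) ∘ₗ (permRep R X).ρ g =
      (permRep R (D.prod X)).ρ g ∘ₗ pairLinear R D X d from LinearMap.congr_fun h v
  refine MonoidAlgebra.lhom_ext' fun x => LinearMap.ext_ring ?_
  refine (congrArg (pairLinear R D X (g • d)) (Representation.ofMulAction_single g x 1)).trans ?_
  refine (pairLinear_single D X _ _).trans (Eq.symm ?_)
  refine (congrArg ((permRep R (D.prod X)).ρ g) (pairLinear_single D X d x)).trans ?_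
  exact Representation.ofMulAction_single g _ 1

lemma permRepMap_prodMap_pairLinear {X Y : GSetCat G} (f : X ⟶ Y) (d : D.carrier)
    (v : permRep R X) :
    (permRepMap R (D.prodMap f)).hom (pairLinear R D X d v) =
      pairLinear R D Y d ((permRepMap R f).hom v) := by
  suffices h : (permRepMap R (D.prodMap f)).hom.toLinearMap ∘ₗ pairLinear R D X d =
      pairLinear R D Y d ∘ₗ (permRepMap R f).hom.toLinearMap from LinearMap.congr_fun h v
  refine MonoidAlgebra.lhom_ext' fun x => LinearMap.ext_ring ?_
  refine (congrArg (permRepMap R (D.prodMap f)).hom (pairLinear_single D X d x)).trans ?_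
  refine (permRepMap_single (D.prodMap f) _).trans (Eq.symm ?_)
  exact (congrArg (pairLinear R D Y d) (permRepMap_single f x)).trans (pairLinear_single D Y d _)

lemma permRepMap_prodSnd_pairLinear (X : GSetCat G) (d : D.carrier) (v : permRep R X) :
    (permRepMap R (D.prodSnd X)).hom (pairLinear R D X d v) = v := by
  suffices h : (permRepMap R (D.prodSnd X)).hom.toLinearMap ∘ₗ pairLinear R D X d =
      LinearMap.id from LinearMap.congr_fun h v
  refine MonoidAlgebra.lhom_ext' fun x => LinearMap.ext_ring ?_
  exact (congrArg (permRepMap R (D.prodSnd X)).hom (pairLinear_single D X d x)).trans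
    (permRepMap_single (D.prodSnd X) _)

/-- The product of the linearization of `δ` with a map `R[G ⧸ K] → R[X]`, on basis elements. -/
noncomputable def pairHom {X : GSetCat G} (φ : permModule R F K ⟶ permRep R X) :
    permModule R F K ⟶ permRep R (D.prod X) :=
  permRepLift (X := transitiveGSet K)
    (fun y => pairLinear R D X (δ y) (φ.hom (MonoidAlgebra.single y 1))) fun g y => by
      rw [map_smul, ← pairLinear_smul, ← Rep.hom_comm_apply]
      congr 2
      exact (Representation.ofMulAction_single g _ _).symm

lemma pairHom_single {X : GSetCat G} (φ : permModule R F K ⟶ permRep R X) (y : G ⧸ K.1) :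
    (pairHom D δ φ).hom (MonoidAlgebra.single y 1) =
      pairLinear R D X (δ y) (φ.hom (MonoidAlgebra.single y 1)) :=
  permRepLift_single (X := transitiveGSet K) _ _ y

lemma pairHom_comp_prodMap {X Y : GSetCat G} (f : X ⟶ Y) (φ : permModule R F K ⟶ permRep R X) :
    pairHom D δ φ ≫ permRepMap R (D.prodMap f) = pairHom D δ (φ ≫ permRepMap R f) :=
  permRep_hom_ext (X := transitiveGSet K) fun y =>
    (congrArg (permRepMap R (D.prodMap f)).hom (pairHom_single D δ φ y)).trans
      ((permRepMap_prodMap_pairLinear D f (δ y) (φ.hom (MonoidAlgebra.single y 1))).trans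
        (pairHom_single D δ (φ ≫ permRepMap R f) y).symm)

lemma pairHom_comp_prodSnd {X : GSetCat G} (φ : permModule R F K ⟶ permRep R X) :
    pairHom D δ φ ≫ permRepMap R (D.prodSnd X) = φ :=
  permRep_hom_ext (X := transitiveGSet K) fun y =>
    (congrArg (permRepMap R (D.prodSnd X)).hom (pairHom_single D δ φ y)).trans
      (permRepMap_prodSnd_pairLinear D X _ _)

variable (R) in
/-- `pairHom` as a linear map. -/
noncomputable def pairHomLinear (X : GSetCat G) :
    (permModule R F K ⟶ permRep R X) →ₗ[R] (permModule R F K ⟶ permRep R (D.prod X)) where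
  toFun := pairHom D δ
  map_add' φ φ' := permRep_hom_ext (X := transitiveGSet K) fun y =>
    (pairHom_single D δ _ y).trans ((map_add (pairLinear R D X (δ y)) _ _).trans
      (congrArg₂ (· + ·) (pairHom_single D δ φ y) (pairHom_single D δ φ' y)).symm)
  map_smul' r φ := permRep_hom_ext (X := transitiveGSet K) fun y =>
    (pairHom_single D δ _ y).trans ((map_smul (pairLinear R D X (δ y)) r _).trans
      (congrArg (r • ·) (pairHom_single D δ φ y)).symm)

variable (R) in
/-- The section of `heckePerm (D × X) → heckePerm X` at `G ⧸ K` given by a `G`-map `δ`. -/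
noncomputable def heckeSection (X : GSetCat G) :
    (heckeEval R F K).obj ((heckePerm R F).obj X) ⟶
      (heckeEval R F K).obj ((heckePerm R F).obj (D.prod X)) :=
  ModuleCat.ofHom (pairHomLinear R D δ X)

lemma heckeSection_naturality {X Y : GSetCat G} (f : X ⟶ Y) :
    heckeSection R D δ X ≫ (heckeEval R F K).map ((heckePerm R F).map (D.prodMap f)) =
      (heckeEval R F K).map ((heckePerm R F).map f) ≫ heckeSection R D δ Y :=
  ModuleCat.hom_ext (LinearMap.ext fun φ => pairHom_comp_prodMap D δ f φ)

lemma heckeSection_comp (X : GSetCat G) :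
    heckeSection R D δ X ≫ (heckeEval R F K).map ((heckePerm R F).map (D.prodSnd X)) = 𝟙 _ :=
  ModuleCat.hom_ext (LinearMap.ext fun φ => pairHom_comp_prodSnd D δ φ)

end Sections

/-! ### The standard resolutions and their comparison -/

/-- The disjoint union of the transitive `G`-sets `G ⧸ H` with `H` in the family. -/
def disjointUnionGSet : GSetCat G where
  carrier := Σ H : F.Mem, G ⧸ H.1

/-- The inclusion of a transitive `G`-set. -/
def toDisjointUnion (K : F.Mem) : (G ⧸ K.1) →[G] (disjointUnionGSet F).carrier :=
  ⟨fun y => ⟨K, y⟩, fun _ _ => rfl⟩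

/-- The stabilizer of a tuple is contained in that of its vertex `0`, a conjugate of some `H ∈ F`.
Both closure properties of the family are used. -/
lemma stabilizer_cech_mem (n : SimplexCategoryᵒᵖ) (x : ((disjointUnionGSet F).cech.obj n).carrier) :
    MulAction.stabilizer G x ∈ F.carrier := by
  obtain ⟨⟨H, y⟩, hx⟩ : ∃ z, (x : Fin (n.unop.len + 1) → _) 0 = z := ⟨_, rfl⟩
  obtain ⟨a, rfl⟩ := QuotientGroup.mk_surjective y
  refine F.subgroup_mem _ (F.conj_mem H.1 H.2 a) _ fun g hg => ?_
  have h0 : g • (x : Fin (n.unop.len + 1) → (disjointUnionGSet F).carrier) 0 =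
      (x : Fin (n.unop.len + 1) → (disjointUnionGSet F).carrier) 0 := congrFun hg 0
  rw [hx] at h0
  have h1 : (QuotientGroup.mk (g * a) : G ⧸ H.1) = QuotientGroup.mk a :=
    eq_of_heq (Sigma.mk.inj h0).2
  refine ⟨a⁻¹ * g * a, ?_, by simp [mul_assoc]⟩
  have h2 := QuotientGroup.eq.1 h1.symm
  simpa [mul_assoc] using h2

/-- The orbit decomposition of the simplices of the Čech nerve. -/
noncomputable def cechDecomposition (n : SimplexCategoryᵒᵖ) :
    OrbitDecomposition F ((disjointUnionGSet F).cech.obj n) :=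
  .ofStabilizers F _ (stabilizer_cech_mem F n)

/-- The standard resolution of the constant module over the orbit category. -/
noncomputable def orbitResolution : ProjectiveResolution (constantOrbitModule R F) :=
  projectiveResolutionOfExtraDegeneracy (orbitEval R F) (fun _ _ => isIso_of_orbitEval R F)
    ((disjointUnionGSet F).augmentedCech (orbitPerm R F) (orbitPermPointIso R F))
    (fun n => orbitPerm_projective (cechDecomposition F n))
    (fun K => (disjointUnionGSet F).extraDegeneracyOfSection _ _ _
      (orbitSection _ (toDisjointUnion F K.stab)) (orbitSection_naturality _ _)
      (orbitSection_comp _ _))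

/-- The standard resolution of `R^-` over the Hecke category. -/
noncomputable def heckeResolution : ProjectiveResolution (trivialFixedPointModule R F) :=
  projectiveResolutionOfExtraDegeneracy (heckeEval R F) (fun _ _ => isIso_of_heckeEval R F)
    ((disjointUnionGSet F).augmentedCech (heckePerm R F) (heckePermPointIso R F))
    (fun n => heckePerm_projective (cechDecomposition F n))
    (fun K => (disjointUnionGSet F).extraDegeneracyOfSection _ _ _
      (heckeSection R _ (toDisjointUnion F K)) (heckeSection_naturality _ _)
      (heckeSection_comp _ _))

/-- Both differentials are alternating sums over the same face maps of `G`-sets, so linearity and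
naturality of `restrictHom` suffice. The chosen orbit decompositions only witness bijectivity and do
not affect the map. -/
lemma restrictHom_resolution_d (M : HeckeModule R F) (i j : ℕ)
    (f : (heckeResolution R F).complex.X j ⟶ M) :
    restrictHomEquiv (cechDecomposition F (op (SimplexCategory.mk i))) M
        ((heckeResolution R F).complex.d i j ≫ f) =
      (orbitResolution R F).complex.d i j ≫
        restrictHomEquiv (cechDecomposition F (op (SimplexCategory.mk j))) M f := by
  by_cases h : j + 1 = i
  · subst h
    have h₁ : (heckeResolution R F).complex.d (j + 1) j = ∑ k : Fin (j + 2),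
        (-1 : ℤ) ^ (k : ℕ) • (heckePerm R F).map ((disjointUnionGSet F).cech.δ k) :=
      AlgebraicTopology.AlternatingFaceMapComplex.obj_d_eq _ _
    have h₂ : (orbitResolution R F).complex.d (j + 1) j = ∑ k : Fin (j + 2),
        (-1 : ℤ) ^ (k : ℕ) • (orbitPerm R F).map ((disjointUnionGSet F).cech.δ k) :=
      AlgebraicTopology.AlternatingFaceMapComplex.obj_d_eq _ _
    rw [h₁, h₂]
    refine (congrArg _ (Preadditive.sum_comp _ _ _)).trans ((map_sum _ _ _).trans
      (Eq.trans ?_ (Preadditive.sum_comp _ _ _).symm))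
    refine Finset.sum_congr rfl fun k _ => ?_
    refine (congrArg _ (Preadditive.zsmul_comp _ _ _)).trans ((map_zsmul _ _ _).trans
      (Eq.trans ?_ (Preadditive.zsmul_comp _ _ _).symm))
    exact congrArg _ (restrictHom_naturality ((disjointUnionGSet F).cech.δ k) f)
  · rw [(heckeResolution R F).complex.shape _ _ h, (orbitResolution R F).complex.shape _ _ h]
    exact (congrArg _ zero_comp).trans ((map_zero _).trans zero_comp.symm)

end Resolutions

theorem mainTheorem7 (R : Type u) [CommRing R] (G : Type u) [Group G]
    (F : FiniteSubgroupFamily G) (M : HeckeModule R F) (n : ℕ) :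
    Nonempty (heckeCohomology R F M n ≃ₗ[R] orbitCohomology R F (resOrbit R F M) n) := by
  let := HasExt.standard (HeckeModule R F)
  let := HasExt.standard (OrbitModule R F)
  exact (heckeResolution R F).nonempty_ext_linearEquiv (orbitResolution R F)
    (fun k => restrictHomEquiv (cechDecomposition F (op (SimplexCategory.mk k))) M)
    (restrictHom_resolution_d R F M) n
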